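/- Fix a coordinate plane. A finite family of lines in the plane is in nearly general position if all of its lines are non-vertical and no two of them are parallel. A family $F$ of lines defines a $k$-cell if some connected component $P$ of the complement of the union of the lines of $F$ has the property that the boundary of $P$ contains a segment of positive length from exactly $k$ of the lines of $F$. A family of $n$ lines is in convex position if it defines an $n$-cell. For integers $l \ge 3$ and $n \ge 2$, let $ES_L(l,n)$ be the minimum $N$ such that every family of $N$ lines in nearly general position contains either $l$ concurrent lines or $n$ lines in convex position. **Theorem 1.2.** Let $l \ge 3$ and $k \ge 2$ be integers. If $n = 2k+2$, then $$ES_L(l,n) > (l-1)\binom{2k-2}{k-1}^2 - (l-3)\binom{2k-4}{k-2}\binom{2k-2}{k-1}.$$ If $n = 2k+1$, then $$ES_L(l,n) > (l-1)\left\{\binom{2k-2}{k-1}+1\right\}\binom{2k-3}{k-1} - (l-3)\binom{2k-4}{k-2}\binom{2k-2}{k-1}.$$ -/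

import Mathlib

/-- A non-vertical line of the coordinate plane: the graph of `y = m x + c`. -/
def IsNonverticalLine (L : Set (ℝ × ℝ)) : Prop :=
  ∃ m c : ℝ, L = {p : ℝ × ℝ | p.2 = m * p.1 + c}

/-- A finite family of lines is in nearly general position if all its lines are non-vertical and
no two of them are parallel, that is, any two distinct lines of the family meet. -/
def NearlyGeneralPosition (F : Finset (Set (ℝ × ℝ))) : Prop :=
  (∀ L ∈ F, IsNonverticalLine L) ∧ ∀ L ∈ F, ∀ M ∈ F, L ≠ M → (L ∩ M).Nonempty

/-- The lines of `F` pass through a common point. -/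
def IsConcurrent (F : Finset (Set (ℝ × ℝ))) : Prop :=
  ∃ p : ℝ × ℝ, ∀ L ∈ F, p ∈ L

/-- `P` is a connected component of the complement of the union of the lines of `F`. -/
def IsComplementComponent (F : Finset (Set (ℝ × ℝ))) (P : Set (ℝ × ℝ)) : Prop :=
  ∃ x ∈ (⋃ L ∈ F, L)ᶜ, P = connectedComponentIn (⋃ L ∈ F, L)ᶜ x

/-- The boundary of `P` contains a segment of positive length of `L`. -/
def ContributesSegment (P L : Set (ℝ × ℝ)) : Prop :=
  ∃ p q : ℝ × ℝ, p ≠ q ∧ segment ℝ p q ⊆ L ∩ frontier P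

/-- `F` defines the `k`-cell `P`: `P` is a connected component of the complement of the union of
the lines of `F`, and the boundary of `P` contains a segment of positive length of exactly `k` of
the lines. -/
def DefinesCell (F : Finset (Set (ℝ × ℝ))) (k : ℕ) (P : Set (ℝ × ℝ)) : Prop :=
  IsComplementComponent F P ∧ {L : Set (ℝ × ℝ) | L ∈ F ∧ ContributesSegment P L}.ncard = k

/-- A family of `n` lines is in convex position if it defines an `n`-cell. -/
def InConvexPosition (F : Finset (Set (ℝ × ℝ))) : Prop :=
  ∃ P : Set (ℝ × ℝ), DefinesCell F F.card P

/-- Every family of `N` lines in nearly general position contains `l` concurrent lines or `n`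
lines in convex position. -/
def ForcesConcurrentOrConvex (l n N : ℕ) : Prop :=
  ∀ F : Finset (Set (ℝ × ℝ)), NearlyGeneralPosition F → F.card = N →
    (∃ G ⊆ F, G.card = l ∧ IsConcurrent G) ∨ (∃ G ⊆ F, G.card = n ∧ InConvexPosition G)

/-- The minimum `N` such that every family of `N` lines in nearly general position contains `l`
concurrent lines or `n` lines in convex position. (If there were no such `N`, the value would be
`0`, so a lower bound by a non-negative number also says that such an `N` exists.) -/
noncomputable def ESL (l n : ℕ) : ℕ :=
  sInf {N : ℕ | ForcesConcurrentOrConvex l n N}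

/-!
The line `y = m x + c` is coded by the pair `(m, c)`. If `A` and `B` are the lines above and below a
cell all of whose lines are sides, every side has a point strictly below the other lines of `A` and
strictly above the other lines of `B` (`IsCell`, `exists_isCell_of_inConvexPosition`); which pairs
`A`, `B` occur depends only on the order of the crossings along each line. The theorem asks for a
large family in which all cells of all subfamilies are small.

Two constructions produce it. Gluing (`Tame.sumElim`, `Tame.exists_sumElim`) translates the codes
of a family `k` so that all crossings of `k` with a family `h` lie far to the left. As in the
recursion of Erdős and Szekeres, cups grow by one from `h`, and caps by one from `k`. The cells with
sides of both kinds `A` and `B` stay bounded by four, whatever the number of gluings, except those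
that are unbounded on the right only: such a cell with sides from both families consists of a cap of
`h` and a cup of `k`. Starting from single lines and pencils of `l - 1` lines this gives the families
of `existsTame_choose`, with at most `p + 2` lines in a cup, `q + 2` in a cap and `p + q + 4` around
any other cell.

Bundling (`exists_isBundling`) replaces every line of such a family `h`, without three concurrent
lines, by a small copy of a second family `k` that has all its crossings far to the left of the
crossings of `h`. A cell to the right of the crossings of `k` uses at most one line of each kind from
a bundle; a cup has several lines from its steepest bundle only, a cap from its least steep one; a
cell that is unbounded on the left only has sides from at most three bundles, unless it lies inside
one bundle, possibly cut off by one more line. This bounds the cells of the bundling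
(`IsBundling.card_le`), and its size is the product of the two sizes. Products of suitable families
are at least as large as the theorem claims, by `(p + 1).centralBinom ≤ 4 * p.centralBinom`
(`existsBounded_even`, `existsBounded_odd`, and `existsBounded_four` in the smallest odd case).

Since `ESL` is an infimum in `ℕ`, it must also be shown that some number of lines forces one of the
two alternatives (`exists_forcesConcurrentOrConvex`). This follows from the theorem of Erdős and
Szekeres on cups and caps, applied to a maximal subfamily without three concurrent lines.
-/

/-! ### Lines, crossings and cells -/

/-- The ordinate at `t` of the line coded by `p = (slope, intercept)`. -/
def height (p : ℝ × ℝ) (t : ℝ) : ℝ := p.1 * t + p.2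

/-- The abscissa at which the lines coded by `p` and `q` cross; meaningful only if their slopes
differ. -/
noncomputable def cross (p q : ℝ × ℝ) : ℝ := (p.2 - q.2) / (q.1 - p.1)

lemma cross_comm (p q : ℝ × ℝ) : cross p q = cross q p := by
  unfold cross
  rw [← neg_sub q.2 p.2, ← neg_sub p.1 q.1, neg_div_neg_eq]

lemma height_lt_iff {p q : ℝ × ℝ} (hpq : p.1 < q.1) (t : ℝ) :
    height p t < height q t ↔ cross p q < t := by
  unfold height cross
  rw [div_lt_iff₀ (sub_pos.2 hpq)]
  constructor <;> intro h <;> nlinarith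

lemma lt_height_iff {p q : ℝ × ℝ} (hpq : p.1 < q.1) (t : ℝ) :
    height q t < height p t ↔ t < cross p q := by
  unfold height cross
  rw [lt_div_iff₀ (sub_pos.2 hpq)]
  constructor <;> intro h <;> nlinarith

lemma height_eq_iff {p q : ℝ × ℝ} (hpq : p.1 ≠ q.1) (t : ℝ) :
    height p t = height q t ↔ t = cross p q := by
  unfold height cross
  rw [eq_div_iff (sub_ne_zero.2 hpq.symm)]
  constructor <;> intro h <;> linarith

/-- The lines indexed by `A` and `B` are exactly the sides of a cell that lies below the lines of
`A` and above the lines of `B`: each of these lines carries a point, with abscissa `t`, that is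
strictly below the other lines of `A` and strictly above the other lines of `B`. -/
def IsCell {ι : Type*} (h : ι → ℝ × ℝ) (A B : Finset ι) : Prop :=
  Disjoint A B ∧ ∀ z, z ∈ A ∨ z ∈ B → ∃ t,
    (∀ a ∈ A, a ≠ z → height (h z) t < height (h a) t) ∧
    ∀ b ∈ B, b ≠ z → height (h b) t < height (h z) t

/-- The abscissae `τ z` of points on the sides `z` of a cell, with the inequalities that they
satisfy relative to the crossings of the lines. -/
structure IsAbscissa {ι : Type*} (h : ι → ℝ × ℝ) (A B : Finset ι) (τ : ι → ℝ) : Prop where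
  right {a b z : ι} (ha : a ∈ A) (hb : b ∈ B) (hz : z ∈ A ∨ z ∈ B) (hba : (h b).1 < (h a).1) :
    cross (h b) (h a) < τ z
  left {a b z : ι} (ha : a ∈ A) (hb : b ∈ B) (hz : z ∈ A ∨ z ∈ B) (hab : (h a).1 < (h b).1) :
    τ z < cross (h a) (h b)
  cup_left {a a' : ι} (ha : a ∈ A) (ha' : a' ∈ A) (haa : (h a).1 < (h a').1) :
    cross (h a) (h a') < τ a
  cup_right {a a' : ι} (ha : a ∈ A) (ha' : a' ∈ A) (haa : (h a).1 < (h a').1) :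
    τ a' < cross (h a) (h a')
  cap_left {b b' : ι} (hb : b ∈ B) (hb' : b' ∈ B) (hbb : (h b).1 < (h b').1) :
    τ b < cross (h b) (h b')
  cap_right {b b' : ι} (hb : b ∈ B) (hb' : b' ∈ B) (hbb : (h b).1 < (h b').1) :
    cross (h b) (h b') < τ b'

section IsCell

variable {ι κ : Type*} {h : ι → ℝ × ℝ} {A B : Finset ι}

lemma IsCell.exists_isAbscissa (H : IsCell h A B) : ∃ τ, IsAbscissa h A B τ := by
  obtain ⟨hd, hz⟩ := H
  have hab : ∀ {a b}, a ∈ A → b ∈ B → a ≠ b := fun ha hb hab =>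
    Finset.disjoint_left.1 hd ha (hab ▸ hb)
  choose! τ h1 h2 using hz
  have key : ∀ {a b z}, a ∈ A → b ∈ B → (z ∈ A ∨ z ∈ B) →
      height (h b) (τ z) < height (h a) (τ z) := by
    intro a b z ha hb hz
    rcases eq_or_ne a z with rfl | hza
    · exact h2 a hz b hb (hab ha hb).symm
    rcases eq_or_ne b z with rfl | hzb
    · exact h1 b hz a ha hza
    exact (h2 z hz b hb hzb).trans (h1 z hz a ha hza)
  have hne : ∀ {i j}, (h i).1 < (h j).1 → i ≠ j := fun hij e => by simp [e] at hij
  refine ⟨τ, ⟨?_, ?_, ?_, ?_, ?_, ?_⟩⟩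
  · intro a b z ha hb hz hba
    exact (height_lt_iff hba _).1 (key ha hb hz)
  · intro a b z ha hb hz hba
    exact (lt_height_iff hba _).1 (key ha hb hz)
  · intro a a' ha ha' haa
    exact (height_lt_iff haa _).1 (h1 a (.inl ha) a' ha' (hne haa).symm)
  · intro a a' ha ha' haa
    exact (lt_height_iff haa _).1 (h1 a' (.inl ha') a ha (hne haa))
  · intro a a' ha ha' haa
    exact (lt_height_iff haa _).1 (h2 a (.inr ha) a' ha' (hne haa).symm)
  · intro a a' ha ha' haa
    exact (height_lt_iff haa _).1 (h2 a' (.inr ha') a ha (hne haa))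

/-- Pulling a cell back along an injection of index types; translating the codes of all lines by
the same vector does not matter. -/
lemma IsCell.comap {k : κ → ℝ × ℝ} {A' B' : Finset κ} (H : IsCell h A B) (f : κ → ι)
    (hf : Function.Injective f) (v : ℝ × ℝ) (hv : ∀ j, h (f j) = k j + v)
    (hA : ∀ j ∈ A', f j ∈ A) (hB : ∀ j ∈ B', f j ∈ B) : IsCell k A' B' := by
  refine ⟨Finset.disjoint_left.2 fun j hj hj' =>
    Finset.disjoint_left.1 H.1 (hA j hj) (hB j hj'), fun z hz => ?_⟩
  obtain ⟨t, h1, h2⟩ := H.2 (f z) (hz.imp (hA z) (hB z))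
  have e : ∀ j, height (h (f j)) t = height (k j) t + height v t := by
    intro j
    simp only [hv, height, Prod.fst_add, Prod.snd_add]
    ring
  refine ⟨t, fun a ha haz => ?_, fun b hb hbz => ?_⟩
  · have := h1 _ (hA a ha) (hf.ne haz)
    rw [e, e] at this
    linarith
  · have := h2 _ (hB b hb) (hf.ne hbz)
    rw [e, e] at this
    linarith

lemma IsCell.mono {A' B' : Finset ι} (H : IsCell h A B) (hA : A' ⊆ A) (hB : B' ⊆ B) :
    IsCell h A' B' :=
  H.comap id Function.injective_id 0 (by simp) (fun _ hj => hA hj) fun _ hj => hB hj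

end IsCell

/-- Bounds for a family of lines with distinct slopes, fewer than `l` of them concurrent: a cell
below all of its sides has at most `u` sides, one above all of its sides at most `v`, one that is
bounded on the left and unbounded on the right at most `r`, one that is bounded on the right and
unbounded on the left at most three, and any other cell at most four. -/
structure Tame {ι : Type*} (h : ι → ℝ × ℝ) (l u v r : ℕ) : Prop where
  inj : Function.Injective fun i => (h i).1
  conc (G : Finset ι) (t y : ℝ) : (∀ i ∈ G, height (h i) t = y) → G.card < l
  cup (A : Finset ι) : IsCell h A ∅ → A.card ≤ u
  cap (B : Finset ι) : IsCell h ∅ B → B.card ≤ v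
  right (A B : Finset ι) : IsCell h A B → A.Nonempty → B.Nonempty →
    (∀ a ∈ A, ∀ b ∈ B, (h b).1 < (h a).1) → A.card + B.card ≤ r
  left (A B : Finset ι) : IsCell h A B → A.Nonempty → B.Nonempty →
    (∀ a ∈ A, ∀ b ∈ B, (h a).1 < (h b).1) → A.card + B.card ≤ 3
  mixed (A B : Finset ι) : IsCell h A B →
    (∃ a ∈ A, ∃ b ∈ B, (h a).1 < (h b).1) → A.card + B.card ≤ 4

section Tame

variable {ι κ : Type*} {h : ι → ℝ × ℝ} {l u v r : ℕ}

lemma Tame.mono {u' v' r' : ℕ} (H : Tame h l u v r) (hu : u ≤ u') (hv : v ≤ v') (hr : r ≤ r') :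
    Tame h l u' v' r' where
  inj := H.inj
  conc := H.conc
  cup A hA := (H.cup A hA).trans hu
  cap B hB := (H.cap B hB).trans hv
  right A B h1 h2 h3 h4 := (H.right A B h1 h2 h3 h4).trans hr
  left := H.left
  mixed := H.mixed

lemma Tame.lt_or_lt (H : Tame h l u v r) {i j : ι} (hij : i ≠ j) :
    (h i).1 < (h j).1 ∨ (h j).1 < (h i).1 :=
  lt_or_gt_of_ne (H.inj.ne hij)

lemma Tame.card_le_one (H : Tame h l u v r) {S : Finset ι}
    (hS : ∀ i ∈ S, ∀ j ∈ S, (h i).1 < (h j).1 → False) : S.card ≤ 1 := by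
  refine Finset.card_le_one.2 fun i hi j hj => by_contra fun hij => ?_
  rcases H.lt_or_lt hij with h1 | h1
  · exact hS i hi j hj h1
  · exact hS j hj i hi h1

lemma Tame.add_right (H : Tame h l u v r) (w : ℝ × ℝ) : Tame (fun i => h i + w) l u v r := by
  have hc : ∀ {A B : Finset ι}, IsCell (fun i => h i + w) A B → IsCell h A B := fun hAB =>
    hAB.comap id Function.injective_id w (fun _ => rfl) (fun _ hj => hj) fun _ hj => hj
  refine ⟨fun i j hij => H.inj (by simpa using hij), fun G t y hG =>
    H.conc G t (y - height w t) fun i hi => ?_, fun A hA => H.cup A (hc hA), fun A hA =>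
    H.cap A (hc hA), fun A B hAB h1 h2 h3 => H.right A B (hc hAB) h1 h2 (by simpa using h3),
    fun A B hAB h1 h2 h3 => H.left A B (hc hAB) h1 h2 (by simpa using h3),
    fun A B hAB h3 => H.mixed A B (hc hAB) (by simpa using h3)⟩
  have := hG i hi
  simp only [height, Prod.fst_add, Prod.snd_add] at this ⊢
  linarith

end Tame

/-! ### Gluing two families -/

section Glue

variable {ι κ : Type*} {h : ι → ℝ × ℝ} {k : κ → ℝ × ℝ} {l u₁ v₁ r₁ u₂ v₂ r₂ : ℕ}

/-- If the lines `k` are steeper than the lines `h`, and all crossings of a line of `h` with a line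
of `k` lie to the left of all other crossings, then the bounds for `h` and `k` combine as in the
recursion of Erdős and Szekeres. The cells that have sides from both families are small, except
those unbounded on the right only, which lie between a cap of `h` and a cup of `k`. -/
theorem Tame.sumElim (Hh : Tame h l u₁ v₁ r₁) (Hk : Tame k l u₂ v₂ r₂) (hl : 3 ≤ l) (x : ℝ)
    (hhk : ∀ i j, (h i).1 < (k j).1) (hx : ∀ i j, cross (h i) (k j) < x)
    (hxh : ∀ i i', i ≠ i' → x < cross (h i) (h i'))
    (hxk : ∀ j j', j ≠ j' → x < cross (k j) (k j')) :
    Tame (Sum.elim h k) l (max (u₁ + 1) u₂) (max v₁ (v₂ + 1)) (max (max r₁ r₂) (v₁ + u₂)) := by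
  have hxh' : ∀ {i i'}, (h i).1 < (h i').1 → x < cross (h i) (h i') := fun hi =>
    hxh _ _ fun e => by simp [e] at hi
  have hxk' : ∀ {i i'}, (k i).1 < (k i').1 → x < cross (k i) (k i') := fun hi =>
    hxk _ _ fun e => by simp [e] at hi
  have toL : ∀ {A B : Finset (ι ⊕ κ)}, IsCell (Sum.elim h k) A B →
      IsCell h A.toLeft B.toLeft := fun hAB =>
    hAB.comap Sum.inl Sum.inl_injective 0 (by simp) (fun _ hj => Finset.mem_toLeft.1 hj)
      fun _ hj => Finset.mem_toLeft.1 hj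
  have toR : ∀ {A B : Finset (ι ⊕ κ)}, IsCell (Sum.elim h k) A B →
      IsCell k A.toRight B.toRight := fun hAB =>
    hAB.comap Sum.inr Sum.inr_injective 0 (by simp) (fun _ hj => Finset.mem_toRight.1 hj)
      fun _ hj => Finset.mem_toRight.1 hj
  -- A cup with a line of `h` has only one line of `k`, and dually for caps.
  have cupR : ∀ {A B : Finset (ι ⊕ κ)}, IsCell (Sum.elim h k) A B → A.toLeft.Nonempty →
      A.toRight.card ≤ 1 := by
    rintro A B hAB ⟨a, ha⟩
    obtain ⟨τ, hτ⟩ := hAB.exists_isAbscissa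
    refine Hk.card_le_one fun i hi j hj hij => ?_
    rw [Finset.mem_toLeft] at ha
    rw [Finset.mem_toRight] at hi hj
    have h1 := hτ.cup_left hi hj hij
    have h2 := hτ.cup_right ha hi (hhk _ _)
    simp only [Sum.elim_inl, Sum.elim_inr] at h1 h2
    linarith [hx a i, hxk' hij]
  have capL : ∀ {A B : Finset (ι ⊕ κ)}, IsCell (Sum.elim h k) A B → B.toRight.Nonempty →
      B.toLeft.card ≤ 1 := by
    rintro A B hAB ⟨b, hb⟩
    obtain ⟨τ, hτ⟩ := hAB.exists_isAbscissa
    refine Hh.card_le_one fun i hi j hj hij => ?_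
    rw [Finset.mem_toLeft] at hi hj
    rw [Finset.mem_toRight] at hb
    have h1 := hτ.cap_right hi hj hij
    have h2 := hτ.cap_left hj hb (hhk _ _)
    simp only [Sum.elim_inl, Sum.elim_inr] at h1 h2
    linarith [hx j b, hxh' hij]
  have card_eq : ∀ A : Finset (ι ⊕ κ), A.card = A.toLeft.card + A.toRight.card := fun A =>
    Finset.card_toLeft_add_card_toRight.symm
  -- The cells that are not unbounded on the right only.
  have main : ∀ {A B : Finset (ι ⊕ κ)}, IsCell (Sum.elim h k) A B →
      (∃ a ∈ A, ∃ b ∈ B, (Sum.elim h k a).1 < (Sum.elim h k b).1) → A.card + B.card ≤ 4 ∧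
      ((∀ a ∈ A, ∀ b ∈ B, (Sum.elim h k a).1 < (Sum.elim h k b).1) → A.card + B.card ≤ 3) := by
    intro A B hAB hex
    have hL := toL hAB
    have hR := toR hAB
    have hcA := card_eq A
    have hcB := card_eq B
    obtain ⟨τ, hτ⟩ := hAB.exists_isAbscissa
    rcases A.toLeft.eq_empty_or_nonempty with hAL | hAL <;>
      rcases B.toRight.eq_empty_or_nonempty with hBR | hBR
    · -- `A` in `k` and `B` in `h`: every line of `A` is steeper than every line of `B`.
      obtain ⟨a, ha, b, hb, hab⟩ := hex
      rcases a with a | a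
      · simp [← Finset.mem_toLeft, hAL] at ha
      rcases b with b | b
      · exact absurd hab (not_lt.2 (hhk _ _).le)
      · simp [← Finset.mem_toRight, hBR] at hb
    · have hAR : ∀ a ∈ A, ∃ j ∈ A.toRight, a = Sum.inr j := by
        rintro (a | a) ha
        · simp [← Finset.mem_toLeft, hAL] at ha
        · exact ⟨a, Finset.mem_toRight.2 ha, rfl⟩
      rcases B.toLeft.eq_empty_or_nonempty with hBL | ⟨b, hb⟩
      · have hBR' : ∀ b ∈ B, ∃ j ∈ B.toRight, b = Sum.inr j := by
          rintro (b | b) hb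
          · simp [← Finset.mem_toLeft, hBL] at hb
          · exact ⟨b, Finset.mem_toRight.2 hb, rfl⟩
        obtain ⟨a, ha, b, hb, hab⟩ := hex
        obtain ⟨a, ha', rfl⟩ := hAR a ha
        obtain ⟨b, hb', rfl⟩ := hBR' b hb
        rw [hcA, hcB, hAL, hBL, Finset.card_empty, zero_add, zero_add]
        refine ⟨Hk.mixed _ _ hR ⟨a, ha', b, hb', hab⟩, fun H => Hk.left _ _ hR ⟨a, ha'⟩ ⟨b, hb'⟩ ?_⟩
        intro i hi j hj
        exact H (.inr i) (Finset.mem_toRight.1 hi) (.inr j) (Finset.mem_toRight.1 hj)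
      · obtain ⟨a, ha, -⟩ := hex
        obtain ⟨a, ha', rfl⟩ := hAR a ha
        rw [Finset.mem_toLeft] at hb
        have hleft := Hk.left _ _ hR ⟨a, ha'⟩ hBR fun i hi j hj => by
          rw [Finset.mem_toRight] at hi hj
          refine (Hk.lt_or_lt fun e => ?_).resolve_right fun hji => ?_
          · subst e; exact Finset.disjoint_left.1 hAB.1 hi hj
          · have h1 := hτ.right hi hj (.inr hb) hji
            have h2 := hτ.cap_left hb hj (hhk _ _)
            simp only [Sum.elim_inl, Sum.elim_inr] at h1 h2
            linarith [hx b j, hxk' hji]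
        have := capL hAB hBR
        rw [hAL, Finset.card_empty] at hcA
        exact ⟨by omega, fun H => absurd (H _ ha _ hb) (not_lt.2 (hhk _ _).le)⟩
    · have hBL : ∀ b ∈ B, ∃ j ∈ B.toLeft, b = Sum.inl j := by
        rintro (b | b) hb
        · exact ⟨b, Finset.mem_toLeft.2 hb, rfl⟩
        · simp [← Finset.mem_toRight, hBR] at hb
      rcases A.toRight.eq_empty_or_nonempty with hAR | ⟨a, ha⟩
      · have hAL' : ∀ a ∈ A, ∃ j ∈ A.toLeft, a = Sum.inl j := by
          rintro (a | a) ha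
          · exact ⟨a, Finset.mem_toLeft.2 ha, rfl⟩
          · simp [← Finset.mem_toRight, hAR] at ha
        obtain ⟨a, ha, b, hb, hab⟩ := hex
        obtain ⟨a, ha', rfl⟩ := hAL' a ha
        obtain ⟨b, hb', rfl⟩ := hBL b hb
        rw [hcA, hcB, hAR, hBR, Finset.card_empty, add_zero, add_zero]
        refine ⟨Hh.mixed _ _ hL ⟨a, ha', b, hb', hab⟩, fun H => Hh.left _ _ hL ⟨a, ha'⟩ ⟨b, hb'⟩ ?_⟩
        intro i hi j hj
        exact H (.inl i) (Finset.mem_toLeft.1 hi) (.inl j) (Finset.mem_toLeft.1 hj)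
      · obtain ⟨-, -, b, hb, -⟩ := hex
        obtain ⟨b, hb', rfl⟩ := hBL b hb
        have hleft := Hh.left _ _ hL hAL ⟨b, hb'⟩ fun i hi j hj => by
          rw [Finset.mem_toLeft] at hi hj
          rw [Finset.mem_toRight] at ha
          refine (Hh.lt_or_lt fun e => ?_).resolve_right fun hji => ?_
          · subst e; exact Finset.disjoint_left.1 hAB.1 hi hj
          · have h1 := hτ.right hi hj (.inl ha) hji
            have h2 := hτ.cup_right hi ha (hhk _ _)
            simp only [Sum.elim_inl, Sum.elim_inr] at h1 h2
            linarith [hx i a, hxh' hji]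
        have := cupR hAB hAL
        rw [hBR, Finset.card_empty] at hcB
        rw [Finset.mem_toRight] at ha
        exact ⟨by omega, fun H => absurd (H _ ha _ hb) (not_lt.2 (hhk _ _).le)⟩
    · -- The cell lies to the left of `x`, where both families look like pencils of lines.
      obtain ⟨a₀, ha₀⟩ := hAL
      obtain ⟨b₀, hb₀⟩ := hBR
      rw [Finset.mem_toLeft] at ha₀
      rw [Finset.mem_toRight] at hb₀
      have hlt : ∀ z, z ∈ A ∨ z ∈ B → τ z < x := fun z hz =>
        (hτ.left ha₀ hb₀ hz (hhk _ _)).trans (hx _ _)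
      have h1 : A.toLeft.card ≤ 1 := Hh.card_le_one fun i hi j hj hij => by
        rw [Finset.mem_toLeft] at hi hj
        have := hτ.cup_left hi hj hij
        simp only [Sum.elim_inl] at this
        linarith [hlt _ (.inl hi), hxh' hij]
      have h2 : A.toRight.card ≤ 1 := Hk.card_le_one fun i hi j hj hij => by
        rw [Finset.mem_toRight] at hi hj
        have := hτ.cup_left hi hj hij
        simp only [Sum.elim_inr] at this
        linarith [hlt _ (.inl hi), hxk' hij]
      have h3 : B.toLeft.card ≤ 1 := Hh.card_le_one fun i hi j hj hij => by
        rw [Finset.mem_toLeft] at hi hj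
        have := hτ.cap_right hi hj hij
        simp only [Sum.elim_inl] at this
        linarith [hlt _ (.inr hj), hxh' hij]
      have h4 : B.toRight.card ≤ 1 := Hk.card_le_one fun i hi j hj hij => by
        rw [Finset.mem_toRight] at hi hj
        have := hτ.cap_right hi hj hij
        simp only [Sum.elim_inr] at this
        linarith [hlt _ (.inr hj), hxk' hij]
      refine ⟨by omega, fun H => ?_⟩
      rcases A.toRight.eq_empty_or_nonempty with hAR | ⟨a, ha⟩
      · rw [hAR, Finset.card_empty] at hcA; omega
      rcases B.toLeft.eq_empty_or_nonempty with hBL | ⟨b, hb⟩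
      · rw [hBL, Finset.card_empty] at hcB; omega
      exact absurd (H _ (Finset.mem_toRight.1 ha) _ (Finset.mem_toLeft.1 hb))
        (not_lt.2 (hhk _ _).le)
  refine ⟨?_, ?_, ?_, ?_, ?_, fun A B hAB hA hB H => ?_, fun A B hAB H => (main hAB H).1⟩
  · rintro (i | i) (j | j) hij
    · exact congrArg _ (Hh.inj hij)
    · exact absurd hij (hhk _ _).ne
    · exact absurd hij (hhk _ _).ne'
    · exact congrArg _ (Hk.inj hij)
  · intro G t y hG
    have hG1 : ∀ i ∈ G.toLeft, height (h i) t = y := fun i hi => hG _ (Finset.mem_toLeft.1 hi)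
    have hG2 : ∀ i ∈ G.toRight, height (k i) t = y := fun i hi => hG _ (Finset.mem_toRight.1 hi)
    have h1 := Hh.conc _ t y hG1
    have h2 := Hk.conc _ t y hG2
    rw [card_eq]
    rcases G.toLeft.eq_empty_or_nonempty with hGL | ⟨a, ha⟩
    · rwa [hGL, Finset.card_empty, zero_add]
    rcases G.toRight.eq_empty_or_nonempty with hGR | ⟨b, hb⟩
    · rwa [hGR, Finset.card_empty, add_zero]
    have ht : t < x := by
      rw [(height_eq_iff (hhk a b).ne t).1 ((hG1 a ha).trans (hG2 b hb).symm)]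
      exact hx a b
    have h3 : G.toLeft.card ≤ 1 := Hh.card_le_one fun i hi j hj hij => by
      have := (height_eq_iff hij.ne t).1 ((hG1 i hi).trans (hG1 j hj).symm)
      linarith [hxh' hij]
    have h4 : G.toRight.card ≤ 1 := Hk.card_le_one fun i hi j hj hij => by
      have := (height_eq_iff hij.ne t).1 ((hG2 i hi).trans (hG2 j hj).symm)
      linarith [hxk' hij]
    omega
  · intro A hA
    have h1 := Hh.cup _ (toL hA)
    have h2 := Hk.cup _ (toR hA)
    rw [card_eq]
    rcases A.toLeft.eq_empty_or_nonempty with hAL | hAL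
    · rw [hAL, Finset.card_empty]; omega
    · have := cupR hA hAL; omega
  · intro A hA
    have h1 := Hh.cap _ (toL hA)
    have h2 := Hk.cap _ (toR hA)
    rw [card_eq]
    rcases A.toRight.eq_empty_or_nonempty with hAR | hAR
    · rw [hAR, Finset.card_empty]; omega
    · have := capL hA hAR; omega
  · intro A B hAB hA hB H
    have hL := toL hAB
    have hR := toR hAB
    obtain ⟨τ, hτ⟩ := hAB.exists_isAbscissa
    have hnot : ∀ i j, Sum.inl i ∈ A → Sum.inr j ∈ B → False := fun i j hi hj =>
      absurd (H _ hi _ hj) (not_lt.2 (hhk _ _).le)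
    have hB' : B.toRight = ∅ ∨ B.toLeft = ∅ := by
      by_contra! hne
      obtain ⟨⟨b', hb'⟩, b, hb⟩ := hne
      rw [Finset.mem_toLeft] at hb
      rw [Finset.mem_toRight] at hb'
      obtain ⟨a | a, ha⟩ := hA
      · exact hnot _ _ ha hb'
      have h1 := hτ.right ha hb' (.inr hb) (H _ ha _ hb')
      have h2 := hτ.cap_left hb hb' (hhk _ _)
      have h3 := H _ ha _ hb'
      simp only [Sum.elim_inl, Sum.elim_inr] at h1 h2 h3
      linarith [hxk' h3, hx b b']
    have hA' : A.toLeft = ∅ ∨ A.toRight = ∅ := by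
      by_contra! hne
      obtain ⟨⟨a, ha⟩, a', ha'⟩ := hne
      rw [Finset.mem_toLeft] at ha
      rw [Finset.mem_toRight] at ha'
      obtain ⟨b | b, hb⟩ := hB
      swap
      · exact hnot _ _ ha hb
      have h1 := hτ.right ha hb (.inl ha') (H _ ha _ hb)
      have h2 := hτ.cup_right ha ha' (hhk _ _)
      have h3 := H _ ha _ hb
      simp only [Sum.elim_inl, Sum.elim_inr] at h1 h2 h3
      linarith [hxh' h3, hx a a']
    have hcA := card_eq A
    have hcB := card_eq B
    rcases hA' with hA' | hA' <;> rcases hB' with hB' | hB' <;>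
      rw [hA', Finset.card_empty] at hcA <;> rw [hB', Finset.card_empty] at hcB
    · have h1 := Hh.cap _ (hL.mono (Finset.empty_subset _) subset_rfl)
      have h2 := Hk.cup _ (hR.mono subset_rfl (Finset.empty_subset _))
      omega
    · have h2 := Hk.right _ _ hR (Finset.card_pos.1 (by have := hA.card_pos; omega))
        (Finset.card_pos.1 (by have := hB.card_pos; omega)) fun i hi j hj =>
          H (.inr i) (Finset.mem_toRight.1 hi) (.inr j) (Finset.mem_toRight.1 hj)
      omega
    · have h2 := Hh.right _ _ hL (Finset.card_pos.1 (by have := hA.card_pos; omega))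
        (Finset.card_pos.1 (by have := hB.card_pos; omega)) fun i hi j hj =>
          H (.inl i) (Finset.mem_toLeft.1 hi) (.inl j) (Finset.mem_toLeft.1 hj)
      omega
    · obtain ⟨a, ha⟩ : A.toLeft.Nonempty := Finset.card_pos.1 (by have := hA.card_pos; omega)
      obtain ⟨b, hb⟩ : B.toRight.Nonempty := Finset.card_pos.1 (by have := hB.card_pos; omega)
      exact (hnot a b (Finset.mem_toLeft.1 ha) (Finset.mem_toRight.1 hb)).elim
  · obtain ⟨a, ha⟩ := hA
    obtain ⟨b, hb⟩ := hB
    exact (main hAB ⟨a, ha, b, hb, H a ha b hb⟩).2 H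

end Glue

/-! ### Families of the Erdős–Szekeres type -/

/-- A real-valued function on a finite type has a strict lower bound. -/
lemma exists_forall_lt_of_finite {α : Type*} [Finite α] (f : α → ℝ) : ∃ x, ∀ a, x < f a := by
  obtain ⟨x, hx⟩ := (Set.finite_range f).bddBelow
  exact ⟨x - 1, fun a => (sub_one_lt x).trans_le (hx ⟨a, rfl⟩)⟩

/-- A real-valued function on a finite type has a strict upper bound. -/
lemma exists_forall_gt_of_finite {α : Type*} [Finite α] (f : α → ℝ) : ∃ x, ∀ a, f a < x := by
  obtain ⟨x, hx⟩ := (Set.finite_range f).bddAbove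
  exact ⟨x + 1, fun a => (hx ⟨a, rfl⟩).trans_lt (lt_add_one x)⟩

lemma cross_add_right (p q w : ℝ × ℝ) : cross (p + w) (q + w) = cross p q := by
  simp [cross]

/-- Any two finite families can be brought into the position of `Tame.sumElim` by a translation of
the codes of the lines of one of them, which does not move the crossings inside the family. -/
theorem Tame.exists_sumElim {ι κ : Type*} [Finite ι] [Finite κ] {h : ι → ℝ × ℝ} {k : κ → ℝ × ℝ}
    {l u₁ v₁ r₁ u₂ v₂ r₂ : ℕ} (Hh : Tame h l u₁ v₁ r₁) (Hk : Tame k l u₂ v₂ r₂) (hl : 3 ≤ l) :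
    ∃ w, Tame (Sum.elim h fun j => k j + w) l (max (u₁ + 1) u₂) (max v₁ (v₂ + 1))
      (max (max r₁ r₂) (v₁ + u₂)) := by
  obtain ⟨x₁, hx₁⟩ := exists_forall_lt_of_finite fun p : ι × ι => cross (h p.1) (h p.2)
  obtain ⟨x₂, hx₂⟩ := exists_forall_lt_of_finite fun p : κ × κ => cross (k p.1) (k p.2)
  obtain ⟨a, ha⟩ := exists_forall_gt_of_finite fun p : ι × κ => (h p.1).1 - (k p.2).1
  obtain ⟨b, hb⟩ := exists_forall_gt_of_finite fun p : ι × κ =>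
    height (h p.1) (min x₁ x₂) - height (k p.2) (min x₁ x₂) - a * min x₁ x₂
  have hhk : ∀ i j, (h i).1 < (k j + (a, b)).1 := fun i j => by
    have := ha (i, j)
    simp only [Prod.fst_add] at this ⊢
    linarith
  refine ⟨(a, b), Hh.sumElim (Hk.add_right (a, b)) hl (min x₁ x₂) hhk (fun i j => ?_)
    (fun i i' _ => (min_le_left _ _).trans_lt (hx₁ (i, i'))) fun j j' _ => ?_⟩
  · rw [← height_lt_iff (hhk i j)]
    have := hb (i, j)
    simp only [height, Prod.fst_add, Prod.snd_add] at this ⊢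
    linarith
  · rw [cross_add_right]
    exact (min_le_right _ _).trans_lt (hx₂ (j, j'))

/-- A family formed by a single line. -/
lemma tame_point {l : ℕ} (hl : 2 ≤ l) : Tame (fun _ : Unit => ((0 : ℝ), (0 : ℝ))) l 1 1 1 where
  inj _ _ _ := rfl
  conc G _ _ _ := (Finset.card_le_univ G).trans_lt (by rw [Fintype.card_unit]; exact hl)
  cup A _ := (Finset.card_le_univ A).trans (by simp)
  cap A _ := (Finset.card_le_univ A).trans (by simp)
  right A B _ := fun ⟨_, ha⟩ ⟨_, hb⟩ h => absurd (h _ ha _ hb) (lt_irrefl _)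
  left A B _ := fun ⟨_, ha⟩ ⟨_, hb⟩ h => absurd (h _ ha _ hb) (lt_irrefl _)
  mixed A B _ := fun ⟨_, _, _, _, h⟩ => absurd h (lt_irrefl _)

/-- A family formed by `l - 1` lines through the origin. -/
lemma tame_pencil {l : ℕ} (hl : 1 ≤ l) :
    Tame (fun i : Fin (l - 1) => (((i : ℕ) : ℝ), (0 : ℝ))) l 2 2 2 := by
  set h : Fin (l - 1) → ℝ × ℝ := fun i => (((i : ℕ) : ℝ), (0 : ℝ)) with hh
  have hinj : Function.Injective fun i => (h i).1 := fun i j hij => by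
    simpa [hh, Fin.ext_iff] using hij
  have hc : ∀ i j, cross (h i) (h j) = 0 := fun i j => by simp [hh, cross]
  have one : ∀ S : Finset (Fin (l - 1)), (∀ i ∈ S, ∀ j ∈ S, (h i).1 < (h j).1 → False) →
      S.card ≤ 1 := fun S hS => Finset.card_le_one.2 fun i hi j hj => by_contra fun hij => by
    rcases lt_or_gt_of_ne (hinj.ne hij) with h1 | h1
    · exact hS i hi j hj h1
    · exact hS j hj i hi h1
  have split : ∀ (S : Finset (Fin (l - 1))) (τ : Fin (l - 1) → ℝ),
      (∀ i ∈ S, ∀ j ∈ S, (h i).1 < (h j).1 → τ i < 0 ∧ 0 < τ j ∨ 0 < τ i ∧ τ j < 0) →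
      S.card ≤ 2 := by
    intro S τ hS
    rw [← Finset.card_filter_add_card_filter_not (s := S) fun i => 0 < τ i]
    have h1 : (S.filter fun i => 0 < τ i).card ≤ 1 := one _ fun i hi j hj hij => by
      rw [Finset.mem_filter] at hi hj
      rcases hS i hi.1 j hj.1 hij with h | h <;> linarith [hi.2, hj.2]
    have h2 : (S.filter fun i => ¬ 0 < τ i).card ≤ 1 := one _ fun i hi j hj hij => by
      rw [Finset.mem_filter] at hi hj
      rcases hS i hi.1 j hj.1 hij with h | h <;> linarith [hi.2, hj.2]
    omega
  refine ⟨hinj, fun G t y _ => (Finset.card_le_univ G).trans_lt (by simp; omega), fun A hA => ?_,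
    fun B hB => ?_, fun A B hAB ⟨a, ha⟩ ⟨b, hb⟩ H => ?_, fun A B hAB ⟨a, ha⟩ ⟨b, hb⟩ H => ?_,
    fun A B hAB ⟨a, ha, b, hb, H⟩ => ?_⟩
  · obtain ⟨τ, hτ⟩ := hA.exists_isAbscissa
    exact split A τ fun i hi j hj hij => .inr
      ⟨by simpa [hc] using hτ.cup_left hi hj hij, by simpa [hc] using hτ.cup_right hi hj hij⟩
  · obtain ⟨τ, hτ⟩ := hB.exists_isAbscissa
    exact split B τ fun i hi j hj hij => .inl
      ⟨by simpa [hc] using hτ.cap_left hi hj hij, by simpa [hc] using hτ.cap_right hi hj hij⟩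
  · obtain ⟨τ, hτ⟩ := hAB.exists_isAbscissa
    have hpos : ∀ z, z ∈ A ∨ z ∈ B → 0 < τ z := fun z hz => by
      simpa [hc] using hτ.right ha hb hz (H a ha b hb)
    have h1 := one A fun i hi j hj hij =>
      (hpos j (.inl hj)).not_gt (by simpa [hc] using hτ.cup_right hi hj hij)
    have h2 := one B fun i hi j hj hij =>
      (hpos i (.inr hi)).not_gt (by simpa [hc] using hτ.cap_left hi hj hij)
    omega
  all_goals
    obtain ⟨τ, hτ⟩ := hAB.exists_isAbscissa
    have hneg : ∀ z, z ∈ A ∨ z ∈ B → τ z < 0 := fun z hz => by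
      first
      | simpa [hc] using hτ.left ha hb hz H
      | simpa [hc] using hτ.left ha hb hz (H a ha b hb)
    have h1 := one A fun i hi j hj hij =>
      (hneg i (.inl hi)).not_gt (by simpa [hc] using hτ.cup_left hi hj hij)
    have h2 := one B fun i hi j hj hij =>
      (hneg j (.inr hj)).not_gt (by simpa [hc] using hτ.cap_right hi hj hij)
    omega

/-- There is a family of `N` lines with the bounds `Tame _ l u v r`. -/
def ExistsTame (N l u v r : ℕ) : Prop :=
  ∃ (ι : Type) (_ : Fintype ι) (h : ι → ℝ × ℝ), Fintype.card ι = N ∧ Tame h l u v r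

lemma ExistsTame.mono {N l u v r u' v' r' : ℕ} (H : ExistsTame N l u v r) (hu : u ≤ u')
    (hv : v ≤ v') (hr : r ≤ r') : ExistsTame N l u' v' r' := by
  obtain ⟨ι, _, h, hN, H⟩ := H
  exact ⟨ι, _, h, hN, H.mono hu hv hr⟩

lemma ExistsTame.add {N₁ N₂ l u₁ v₁ r₁ u₂ v₂ r₂ : ℕ} (H₁ : ExistsTame N₁ l u₁ v₁ r₁)
    (H₂ : ExistsTame N₂ l u₂ v₂ r₂) (hl : 3 ≤ l) :
    ExistsTame (N₁ + N₂) l (max (u₁ + 1) u₂) (max v₁ (v₂ + 1)) (max (max r₁ r₂) (v₁ + u₂)) := by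
  obtain ⟨ι, _, h, rfl, H₁⟩ := H₁
  obtain ⟨κ, _, k, rfl, H₂⟩ := H₂
  obtain ⟨w, H⟩ := H₁.exists_sumElim H₂ hl
  exact ⟨ι ⊕ κ, inferInstance, _, Fintype.card_sum, H⟩

lemma existsTame_point {l : ℕ} (hl : 2 ≤ l) : ExistsTame 1 l 1 1 1 :=
  ⟨Unit, inferInstance, _, Fintype.card_unit, tame_point hl⟩

lemma existsTame_pencil {l : ℕ} (hl : 1 ≤ l) : ExistsTame (l - 1) l 2 2 2 :=
  ⟨Fin (l - 1), inferInstance, _, Fintype.card_fin _, tame_pencil hl⟩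

/-- The families of Erdős and Szekeres, with pencils of `l - 1` lines as the building blocks. -/
theorem existsTame_choose {l : ℕ} (hl : 3 ≤ l) : ∀ p q : ℕ,
    ExistsTame ((p + q + 2).choose (p + 1) + (l - 3) * (p + q).choose p) l (p + 2) (q + 2)
      (p + q + 4)
  | 0, 0 => by
    have := (existsTame_pencil (l := l) (by omega)).mono le_rfl le_rfl (by omega : 2 ≤ 4)
    convert this using 1
    simp
    omega
  | p + 1, 0 => by
    have := ((existsTame_choose hl p 0).add (existsTame_point (by omega)) hl).mono
      (u' := p + 1 + 2) (v' := 0 + 2) (r' := p + 1 + 0 + 4) (by omega) (by omega) (by omega)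
    convert this using 1
    simp [Nat.choose_succ_self_right]
    omega
  | 0, q + 1 => by
    have := ((existsTame_point (by omega)).add (existsTame_choose hl 0 q) hl).mono
      (u' := 0 + 2) (v' := q + 1 + 2) (r' := 0 + (q + 1) + 4) (by omega) (by omega) (by omega)
    convert this using 1
    simp
    omega
  | p + 1, q + 1 => by
    have := ((existsTame_choose hl p (q + 1)).add (existsTame_choose hl (p + 1) q) hl).mono
      (u' := p + 1 + 2) (v' := q + 1 + 2) (r' := p + 1 + (q + 1) + 4)
      (by omega) (by omega) (by omega)
    convert this using 1
    have e1 : p + 1 + (q + 1) + 2 = (p + q + 3) + 1 := by ring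
    have e2 : p + 1 + (q + 1) = (p + q + 1) + 1 := by ring
    rw [e1, e2, Nat.choose_succ_succ, Nat.choose_succ_succ (p + q + 1)]
    have e3 : p + (q + 1) + 2 = p + q + 3 := by ring
    have e4 : p + 1 + q + 2 = p + q + 3 := by ring
    have e5 : p + (q + 1) = p + q + 1 := by ring
    have e6 : p + 1 + q = p + q + 1 := by ring
    rw [e3, e4, e5, e6]
    ring

/-! ### Cells and the order of crossings -/

/-- `p` lies below `q` at `t` if `e` is true, above if it is false. -/
def Side (e : Bool) (p q : ℝ × ℝ) (t : ℝ) : Prop :=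
  if e then height p t < height q t else height q t < height p t

/-- For lines with distinct slopes, the set of abscissae with a given `Side` is a half-line, whose
direction depends only on the side and on the order of the slopes. -/
lemma side_iff (e : Bool) {p q : ℝ × ℝ} (hpq : p.1 ≠ q.1) (t : ℝ) :
    Side e p q t ↔ if e = decide (p.1 < q.1) then cross p q < t else t < cross p q := by
  rcases lt_or_gt_of_ne hpq with h | h <;> cases e <;>
    simp [Side, h, h.not_gt, height_lt_iff h, lt_height_iff h, cross_comm p q]

lemma convex_setOf_side (e : Bool) (p q : ℝ × ℝ) : Convex ℝ {t | Side e p q t} := by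
  have h : ∀ p q : ℝ × ℝ, Convex ℝ {t | height p t < height q t} := by
    intro p q x hx y hy a b ha hb hab
    simp only [Set.mem_ofPred_eq, height, smul_eq_mul] at hx hy ⊢
    have e1 : b = 1 - a := by linarith
    subst e1
    rcases ha.eq_or_lt with rfl | ha
    · linarith
    · nlinarith [mul_lt_mul_of_pos_left hx ha, mul_le_mul_of_nonneg_left hy.le hb]
  cases e
  · simpa [Side] using h q p
  · simpa [Side] using h p q

/-- A one-dimensional application of Helly's theorem: to find a point of the line `z` on the
correct side of every other line it suffices to treat any two other lines. -/
lemma IsCell.of_pairs {ι : Type*} {h : ι → ℝ × ℝ} {A B : Finset ι} [DecidableEq ι]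
    (hinj : Function.Injective fun i => (h i).1) (hd : Disjoint A B)
    (H : ∀ z ∈ A ∪ B, ∀ w ∈ A ∪ B, ∀ w' ∈ A ∪ B, w ≠ z → w' ≠ z → w ≠ w' →
      ∃ t, Side (w ∈ A) (h z) (h w) t ∧ Side (w' ∈ A) (h z) (h w') t) :
    IsCell h A B := by
  refine ⟨hd, fun z hz => ?_⟩
  have hz : z ∈ A ∪ B := Finset.mem_union.2 hz
  obtain ⟨t, ht⟩ := Convex.helly_theorem' (𝕜 := ℝ) (E := ℝ)
      (F := fun w => {t | Side (w ∈ A) (h z) (h w) t}) (s := (A ∪ B).erase z)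
      (fun w _ => convex_setOf_side _ _ _) fun I hI hcard => by
    rw [Module.finrank_self] at hcard
    have hI' : ∀ w ∈ I, w ∈ A ∪ B ∧ w ≠ z := fun w hw =>
      ⟨Finset.mem_of_mem_erase (hI hw), Finset.ne_of_mem_erase (hI hw)⟩
    rcases hcard.lt_or_eq with h1 | h1
    · rcases Finset.eq_empty_or_nonempty I with rfl | ⟨w, hw⟩
      · simp
      · have hw1 : I = {w} := Finset.eq_singleton_iff_unique_mem.2
          ⟨hw, fun y hy => Finset.card_le_one.1 (by omega) y hy w hw⟩
        subst hw1
        have hs := fun t => side_iff (w ∈ A) (hinj.ne (hI' w hw).2.symm) t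
        simp only [Finset.mem_singleton, Set.iInter_iInter_eq_left]
        simp only [Set.Nonempty, Set.mem_ofPred_eq, hs]
        split_ifs
        · exact exists_gt _
        · exact exists_lt _
    · obtain ⟨w, w', hww, rfl⟩ := Finset.card_eq_two.1 h1
      obtain ⟨t, h1, h2⟩ := H z hz w (hI' w (by simp)).1 w' (hI' w' (by simp)).1
        (hI' w (by simp)).2 (hI' w' (by simp)).2 hww
      exact ⟨t, by simpa using ⟨h1, h2⟩⟩
  simp only [Set.mem_iInter, Set.mem_ofPred_eq, Finset.mem_erase, Finset.mem_union] at ht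
  refine ⟨t, fun a ha haz => ?_, fun b hb hbz => ?_⟩
  · have := ht a ⟨haz, .inl ha⟩
    simpa [Side, ha] using this
  · have := ht b ⟨hbz, .inr hb⟩
    simpa [Side, Finset.disjoint_right.1 hd hb] using this

/-- If two triples of lines have the same order of slopes and the same order of crossings on their
first lines, then the existence of a point of the first line with prescribed sides carries over. -/
lemma exists_side_and_side {p q q' P Q Q' : ℝ × ℝ} {e e' : Bool} (hq : p.1 ≠ q.1)
    (hq' : p.1 ≠ q'.1) (hQ : p.1 < q.1 ↔ P.1 < Q.1) (hQ' : p.1 < q'.1 ↔ P.1 < Q'.1)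
    (hPQ : P.1 ≠ Q.1) (hPQ' : P.1 ≠ Q'.1) (hne : cross p q ≠ cross p q')
    (h1 : cross p q < cross p q' → cross P Q < cross P Q')
    (h2 : cross p q' < cross p q → cross P Q' < cross P Q)
    (H : ∃ t, Side e P Q t ∧ Side e' P Q' t) : ∃ t, Side e p q t ∧ Side e' p q' t := by
  obtain ⟨t, H1, H2⟩ := H
  rw [side_iff _ hPQ] at H1
  rw [side_iff _ hPQ'] at H2
  simp only [side_iff e hq, side_iff e' hq', hQ, hQ'] at H1 H2 ⊢
  split_ifs at H1 H2 ⊢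
  · exact ⟨max (cross p q) (cross p q') + 1, by linarith [le_max_left (cross p q) (cross p q')],
      by linarith [le_max_right (cross p q) (cross p q')]⟩
  · refine exists_between ((lt_or_gt_of_ne hne).resolve_right fun h => ?_)
    linarith [h2 h]
  · obtain ⟨s, hs1, hs2⟩ := exists_between ((lt_or_gt_of_ne hne).resolve_left fun h => by
      linarith [h1 h])
    exact ⟨s, hs2, hs1⟩
  · exact ⟨min (cross p q) (cross p q') - 1, by linarith [min_le_left (cross p q) (cross p q')],
      by linarith [min_le_right (cross p q) (cross p q')]⟩

/-- On a line of a family without three concurrent lines, different lines cross at different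
points. -/
lemma Tame.cross_ne {ι : Type*} {h : ι → ℝ × ℝ} {u v r : ℕ} (H : Tame h 3 u v r) {i j k : ι}
    (hij : i ≠ j) (hik : i ≠ k) (hjk : j ≠ k) : cross (h i) (h j) ≠ cross (h i) (h k) := by
  classical
  intro e
  have h1 := (height_eq_iff (H.inj.ne hij) (cross (h i) (h j))).2 rfl
  have h2 := (height_eq_iff (H.inj.ne hik) (cross (h i) (h j))).2 e
  have := H.conc {i, j, k} (cross (h i) (h j)) (height (h i) (cross (h i) (h j)))
    (by simp [← h1, ← h2])
  rw [Finset.card_eq_three.2 ⟨i, j, k, hij, hik, hjk, rfl⟩] at this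
  exact lt_irrefl _ this

/-! ### Replacing the lines of a family by bundles -/

/-- `g` arises from `h` by replacing every line `h i` by a bundle of nearby lines `g (i, j)`, each
bundle being a translate of `k` with all its crossings to the left of `x`, while all crossings of
lines of different bundles lie to the right of `x`, in the order of the crossings of `h`. -/
structure IsBundling {ι κ : Type*} (h : ι → ℝ × ℝ) (k : κ → ℝ × ℝ) (g : ι × κ → ℝ × ℝ) (x : ℝ) :
    Prop where
  slope {i i' : ι} (j j' : κ) : (h i).1 < (h i').1 → (g (i, j)).1 < (g (i', j')).1
  translate (i : ι) : ∃ w, ∀ j, g (i, j) = k j + w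
  same (i : ι) {j j' : κ} : j ≠ j' → cross (g (i, j)) (g (i, j')) < x
  diff {i i' : ι} (j j' : κ) : i ≠ i' → x < cross (g (i, j)) (g (i', j'))
  order {i i' i'' : ι} (j j₂ j' j'' : κ) : i ≠ i' → i ≠ i'' →
    cross (h i) (h i') < cross (h i) (h i'') →
      cross (g (i, j)) (g (i', j')) < cross (g (i, j₂)) (g (i'', j''))

section Bundling

variable {ι κ : Type*} {h : ι → ℝ × ℝ} {k : κ → ℝ × ℝ}
  {g : ι × κ → ℝ × ℝ} {x : ℝ} {l u₁ v₁ r₁ u₂ v₂ r₂ : ℕ} {A B : Finset (ι × κ)} {τ : ι × κ → ℝ}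

lemma IsBundling.slope_same (Hg : IsBundling h k g x) (Hk : Tame k l u₂ v₂ r₂) {p q : ι × κ}
    (hpq : p.1 = q.1) (hne : p ≠ q) : (g p).1 < (g q).1 ∨ (g q).1 < (g p).1 := by
  obtain ⟨i, j⟩ := p
  obtain ⟨i', j'⟩ := q
  obtain rfl : i = i' := hpq
  obtain ⟨w, hw⟩ := Hg.translate i
  rw [hw, hw]
  simpa using Hk.lt_or_lt (i := j) (j := j') fun e => hne (by rw [e])

lemma IsBundling.slope_iff (Hg : IsBundling h k g x) (Hh : Tame h 3 u₁ v₁ r₁) {i i' : ι}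
    (hii : i ≠ i') (j j' : κ) : (h i).1 < (h i').1 ↔ (g (i, j)).1 < (g (i', j')).1 :=
  ⟨Hg.slope j j', fun hlt => (Hh.lt_or_lt hii).resolve_right fun h1 =>
    (Hg.slope j' j h1).not_gt hlt⟩

lemma IsBundling.cross_same (Hg : IsBundling h k g x) {p q : ι × κ} (hpq : p.1 = q.1)
    (hne : (g p).1 < (g q).1) : cross (g p) (g q) < x := by
  obtain ⟨i, j⟩ := p
  obtain ⟨i', j'⟩ := q
  obtain rfl : i = i' := hpq
  exact Hg.same i fun e => by simp [e] at hne

lemma IsBundling.cross_diff (Hg : IsBundling h k g x) {p q : ι × κ} (hpq : p.1 ≠ q.1) :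
    x < cross (g p) (g q) :=
  Hg.diff p.2 q.2 hpq

lemma IsBundling.injective (Hg : IsBundling h k g x) (Hh : Tame h 3 u₁ v₁ r₁)
    (Hk : Tame k l u₂ v₂ r₂) : Function.Injective fun p => (g p).1 := by
  intro p q hpq
  by_contra hne
  rcases eq_or_ne p.1 q.1 with e | e
  · rcases Hg.slope_same Hk e hne with h1 | h1
    exacts [h1.ne hpq, h1.ne' hpq]
  · rcases Hh.lt_or_lt e with h1 | h1
    exacts [(Hg.slope p.2 q.2 h1).ne hpq, (Hg.slope q.2 p.2 h1).ne' hpq]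

variable [DecidableEq ι] [DecidableEq κ]

/-- The members of the bundle `i` that belong to `A`. -/
def fiber (A : Finset (ι × κ)) (i : ι) : Finset κ := (A.filter fun p => p.1 = i).image Prod.snd

@[simp] lemma mem_fiber {i : ι} {j : κ} : j ∈ fiber A i ↔ (i, j) ∈ A := by
  simp [fiber]

lemma card_fiber (A : Finset (ι × κ)) (i : ι) :
    (fiber A i).card = (A.filter fun p => p.1 = i).card := by
  refine Finset.card_image_of_injOn fun p hp q hq hpq => Prod.ext ?_ hpq
  simp only [Finset.coe_filter, Set.mem_ofPred_eq] at hp hq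
  rw [hp.2, hq.2]

/-- If `A` has at most one member in every bundle other than `i`, it is not much larger than the
number of bundles that it meets. -/
lemma card_add_one_le_of_fiber {i : ι} (hi : i ∈ A.image Prod.fst)
    (H : ∀ p ∈ A, ∀ q ∈ A, p.1 = q.1 → p.1 ≠ i → p = q) :
    A.card + 1 ≤ (A.image Prod.fst).card + (fiber A i).card := by
  rw [card_fiber, ← Finset.card_filter_add_card_filter_not (s := A) fun p => p.1 = i]
  have h1 : (A.filter fun p => ¬ p.1 = i).card ≤ ((A.image Prod.fst).erase i).card := by
    refine Finset.card_le_card_of_injOn Prod.fst (fun p hp => ?_) fun p hp q hq hpq => ?_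
    · have hp := Finset.mem_filter.1 hp
      exact Finset.mem_erase.2 ⟨hp.2, Finset.mem_image_of_mem _ hp.1⟩
    · have hp := Finset.mem_filter.1 hp
      have hq := Finset.mem_filter.1 hq
      exact H p hp.1 q hq.1 hpq hp.2
  rw [Finset.card_erase_of_mem hi] at h1
  have : 0 < (A.image Prod.fst).card := Finset.card_pos.2 ⟨i, hi⟩
  omega

/-- Fewer than `l` lines of a bundling are concurrent. -/
lemma IsBundling.conc (Hg : IsBundling h k g x) (Hh : Tame h 3 u₁ v₁ r₁)
    (Hk : Tame k l u₂ v₂ r₂) (hl : 3 ≤ l) {G : Finset (ι × κ)} {t y : ℝ}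
    (hG : ∀ p ∈ G, height (g p) t = y) : G.card < l := by
  have hinj := Hg.injective Hh Hk
  have ht : ∀ p ∈ G, ∀ q ∈ G, p ≠ q → t = cross (g p) (g q) := fun p hp q hq hpq =>
    (height_eq_iff (hinj.ne hpq) t).1 ((hG p hp).trans (hG q hq).symm)
  by_cases hs : ∃ i, ∀ p ∈ G, p.1 = i
  · obtain ⟨i, hi⟩ := hs
    obtain ⟨w, hw⟩ := Hg.translate i
    have e : G.filter (fun p => p.1 = i) = G := Finset.filter_true_of_mem hi
    rw [← e, ← card_fiber]
    refine Hk.conc _ t (y - height w t) fun j hj => ?_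
    have := hG _ (mem_fiber.1 hj)
    rw [hw] at this
    simp only [height, Prod.fst_add, Prod.snd_add] at this ⊢
    linarith
  · rw [not_exists] at hs
    by_contra! hcard
    obtain ⟨p, q, s, hp, hq, hs', hpq, hps, hqs⟩ := Finset.two_lt_card_iff.1 (hl.trans hcard)
    have hx : x < t := by
      obtain ⟨q, hq, hpq⟩ : ∃ q ∈ G, q.1 ≠ p.1 := by simpa using hs p.1
      rw [ht q hq p hp fun e => hpq (by rw [e])]
      exact Hg.cross_diff hpq
    have hne : ∀ p ∈ G, ∀ q ∈ G, p ≠ q → p.1 ≠ q.1 := fun p hp q hq hpq e => by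
      rcases Hg.slope_same Hk e hpq with h1 | h1
      · have := Hg.cross_same e h1
        rw [← ht p hp q hq hpq] at this
        linarith
      · have := Hg.cross_same e.symm h1
        rw [← ht q hq p hp hpq.symm] at this
        linarith
    have h1 := hne p hp q hq hpq
    have h2 := hne p hp s hs' hps
    rcases lt_or_gt_of_ne (Hh.cross_ne h1 h2 (hne q hq s hs' hqs)) with h3 | h3
    · have := Hg.order p.2 p.2 q.2 s.2 h1 h2 h3
      simp only [Prod.mk.eta] at this
      rw [← ht p hp q hq hpq, ← ht p hp s hs' hps] at this
      exact lt_irrefl _ this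
    · have := Hg.order p.2 p.2 s.2 q.2 h2 h1 h3
      simp only [Prod.mk.eta] at this
      rw [← ht p hp q hq hpq, ← ht p hp s hs' hps] at this
      exact lt_irrefl _ this

/-- A cell of a bundling with sides of different kinds in different bundles gives a cell of the
underlying family. -/
lemma IsBundling.isCell_image (Hg : IsBundling h k g x) (Hh : Tame h 3 u₁ v₁ r₁)
    (hAB : IsCell g A B) (hd : Disjoint (A.image Prod.fst) (B.image Prod.fst)) :
    IsCell h (A.image Prod.fst) (B.image Prod.fst) := by
  have hrep : ∀ z ∈ A.image Prod.fst ∪ B.image Prod.fst, ∃ j, ((z, j) ∈ A ∨ (z, j) ∈ B) ∧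
      (z ∈ A.image Prod.fst ↔ (z, j) ∈ A) := by
    intro z hz
    rcases Finset.mem_union.1 hz with hz | hz
    · obtain ⟨p, hp, rfl⟩ := Finset.mem_image.1 hz
      exact ⟨p.2, .inl hp, iff_of_true hz hp⟩
    · obtain ⟨p, hp, rfl⟩ := Finset.mem_image.1 hz
      refine ⟨p.2, .inr hp, iff_of_false (Finset.disjoint_right.1 hd hz) fun hA => ?_⟩
      exact Finset.disjoint_left.1 hAB.1 hA hp
  refine IsCell.of_pairs Hh.inj hd fun z hz w hw w' hw' hwz hwz' hww => ?_
  obtain ⟨j, hj, -⟩ := hrep z hz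
  obtain ⟨m, hm, hmA⟩ := hrep w hw
  obtain ⟨m', hm', hmA'⟩ := hrep w' hw'
  have hne : ∀ {i i' : ι} (j j' : κ), i ≠ i' → (g (i, j)).1 ≠ (g (i', j')).1 := by
    intro i i' j j' hii
    rcases Hh.lt_or_lt hii with h1 | h1
    exacts [(Hg.slope j j' h1).ne, (Hg.slope j' j h1).ne']
  refine exists_side_and_side (P := g (z, j)) (Q := g (w, m)) (Q' := g (w', m'))
    (Hh.inj.ne hwz.symm) (Hh.inj.ne hwz'.symm) (Hg.slope_iff Hh hwz.symm _ _)
    (Hg.slope_iff Hh hwz'.symm _ _) (hne _ _ hwz.symm) (hne _ _ hwz'.symm)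
    (Hh.cross_ne hwz.symm hwz'.symm hww) (Hg.order _ _ _ _ hwz.symm hwz'.symm)
    (Hg.order _ _ _ _ hwz'.symm hwz.symm) ?_
  obtain ⟨t, h1, h2⟩ := hAB.2 (z, j) hj
  have hside : ∀ (w : ι) (m : κ), w ≠ z → ((w, m) ∈ A ∨ (w, m) ∈ B) →
      (w ∈ A.image Prod.fst ↔ (w, m) ∈ A) →
      Side (decide (w ∈ A.image Prod.fst)) (g (z, j)) (g (w, m)) t := by
    intro w m hwz hm hmA
    have hne : (w, m) ≠ (z, j) := fun e => hwz (congrArg Prod.fst e)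
    by_cases hA : (w, m) ∈ A
    · simpa [Side, hmA.2 hA] using h1 _ hA hne
    · have : w ∉ A.image Prod.fst := fun h => hA (hmA.1 h)
      simpa [Side, this] using h2 _ (hm.resolve_left hA) hne
  exact ⟨t, hside w m hwz hm hmA, hside w' m' hwz' hm' hmA'⟩

lemma IsBundling.isCell_fiber (Hg : IsBundling h k g x) (hAB : IsCell g A B) (i : ι) :
    IsCell k (fiber A i) (fiber B i) := by
  obtain ⟨w, hw⟩ := Hg.translate i
  exact hAB.comap (Prod.mk i) (Prod.mk_right_injective i) w hw (fun _ hj => mem_fiber.1 hj)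
    fun _ hj => mem_fiber.1 hj

/-- Only the steepest bundle can contribute several lines to a cup. -/
lemma IsBundling.card_cup (Hg : IsBundling h k g x) (Hh : Tame h 3 u₁ v₁ r₁)
    (Hk : Tame k l u₂ v₂ r₂) (hAB : IsCell g A B) (hA : A.Nonempty) :
    A.card + 1 ≤ (A.image Prod.fst).card + u₂ := by
  obtain ⟨τ, hτ⟩ := hAB.exists_isAbscissa
  obtain ⟨i, hi, hmax⟩ := Finset.exists_max_image (A.image Prod.fst) (fun i => (h i).1) (hA.image _)
  have hcup := Hk.cup _ ((Hg.isCell_fiber hAB i).mono subset_rfl (Finset.empty_subset _))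
  refine (card_add_one_le_of_fiber hi fun p hp q hq hpq hpi => ?_).trans
    (Nat.add_le_add_left hcup _)
  obtain ⟨s, hs, rfl⟩ := Finset.mem_image.1 hi
  by_contra hne
  wlog hlt : (g p).1 < (g q).1 generalizing p q
  · exact this q hq p hp hpq.symm (hpq ▸ hpi) (Ne.symm hne)
      ((Hg.slope_same Hk hpq hne).resolve_left hlt)
  have h1 := Hg.cross_same hpq hlt
  have hqs : q.1 ≠ s.1 := hpq ▸ hpi
  have h2 : (h q.1).1 < (h s.1).1 :=
    (hmax _ (Finset.mem_image_of_mem _ hq)).lt_of_ne (Hh.inj.ne hqs)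
  have h3 := hτ.cup_left hq hs (Hg.slope q.2 s.2 h2)
  linarith [hτ.cup_right hp hq hlt, Hg.cross_diff hqs]

/-- Only the least steep bundle can contribute several lines to a cap. -/
lemma IsBundling.card_cap (Hg : IsBundling h k g x) (Hh : Tame h 3 u₁ v₁ r₁)
    (Hk : Tame k l u₂ v₂ r₂) (hAB : IsCell g A B) (hB : B.Nonempty) :
    B.card + 1 ≤ (B.image Prod.fst).card + v₂ := by
  obtain ⟨τ, hτ⟩ := hAB.exists_isAbscissa
  obtain ⟨i, hi, hmin⟩ := Finset.exists_min_image (B.image Prod.fst) (fun i => (h i).1) (hB.image _)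
  have hcap := Hk.cap _ ((Hg.isCell_fiber hAB i).mono (Finset.empty_subset _) subset_rfl)
  refine (card_add_one_le_of_fiber hi fun p hp q hq hpq hpi => ?_).trans
    (Nat.add_le_add_left hcap _)
  obtain ⟨s, hs, rfl⟩ := Finset.mem_image.1 hi
  by_contra hne
  wlog hlt : (g p).1 < (g q).1 generalizing p q
  · exact this q hq p hp hpq.symm (hpq ▸ hpi) (Ne.symm hne)
      ((Hg.slope_same Hk hpq hne).resolve_left hlt)
  have h1 := Hg.cross_same hpq hlt
  have h2 : (h s.1).1 < (h p.1).1 :=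
    (hmin _ (Finset.mem_image_of_mem _ hp)).lt_of_ne (Hh.inj.ne hpi.symm)
  have h3 := hτ.cap_right hs hp (Hg.slope s.2 p.2 h2)
  linarith [hτ.cap_left hp hq hlt, Hg.cross_diff hpi.symm]

/-- To the right of `x` the lines of a bundle do not cross, so that at most one of them bounds a
cell from above, and at most one from below. -/
lemma IsBundling.injOn_cup (Hg : IsBundling h k g x) (Hk : Tame k l u₂ v₂ r₂)
    (hτ : IsAbscissa g A B τ) (hx : ∀ z, z ∈ A ∨ z ∈ B → x < τ z) {p q : ι × κ} (hp : p ∈ A)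
    (hq : q ∈ A) (hpq : p.1 = q.1) : p = q := by
  by_contra hne
  wlog hlt : (g p).1 < (g q).1 generalizing p q
  · exact this hq hp hpq.symm (Ne.symm hne) ((Hg.slope_same Hk hpq hne).resolve_left hlt)
  linarith [Hg.cross_same hpq hlt, hτ.cup_right hp hq hlt, hx q (.inl hq)]

lemma IsBundling.injOn_cap (Hg : IsBundling h k g x) (Hk : Tame k l u₂ v₂ r₂)
    (hτ : IsAbscissa g A B τ) (hx : ∀ z, z ∈ A ∨ z ∈ B → x < τ z) {p q : ι × κ} (hp : p ∈ B)
    (hq : q ∈ B) (hpq : p.1 = q.1) : p = q := by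
  by_contra hne
  wlog hlt : (g p).1 < (g q).1 generalizing p q
  · exact this hq hp hpq.symm (Ne.symm hne) ((Hg.slope_same Hk hpq hne).resolve_left hlt)
  linarith [Hg.cross_same hpq hlt, hτ.cap_left hp hq hlt, hx p (.inr hp)]

/-- A cell with sides of both kinds, none of the bundles contributing sides of both kinds. -/
lemma IsBundling.card_of_disjoint (Hg : IsBundling h k g x) (Hh : Tame h 3 u₁ v₁ r₁)
    (Hk : Tame k l u₂ v₂ r₂) (hAB : IsCell g A B) (hA : A.Nonempty) (hB : B.Nonempty)
    (hd : Disjoint (A.image Prod.fst) (B.image Prod.fst)) :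
    A.card + B.card ≤ max (max r₁ 4) (u₂ + v₂ + 1) := by
  have hcell := Hg.isCell_image Hh hAB hd
  obtain ⟨τ, hτ⟩ := hAB.exists_isAbscissa
  have hne : ∀ p ∈ A, ∀ q ∈ B, p.1 ≠ q.1 := fun p hp q hq e =>
    Finset.disjoint_left.1 hd (Finset.mem_image_of_mem _ hp)
      (e ▸ Finset.mem_image_of_mem _ hq)
  by_cases hright : ∃ p ∈ A, ∃ q ∈ B, (h q.1).1 < (h p.1).1
  · -- The cell lies to the right of `x`.
    obtain ⟨p, hp, q, hq, hqp⟩ := hright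
    have hx : ∀ z, z ∈ A ∨ z ∈ B → x < τ z := fun z hz =>
      (Hg.cross_diff (hne p hp q hq).symm).trans (hτ.right hp hq hz (Hg.slope q.2 p.2 hqp))
    have hcA : (A.image Prod.fst).card = A.card :=
      Finset.card_image_of_injOn fun p hp q hq => Hg.injOn_cup Hk hτ hx hp hq
    have hcB : (B.image Prod.fst).card = B.card :=
      Finset.card_image_of_injOn fun p hp q hq => Hg.injOn_cap Hk hτ hx hp hq
    rw [← hcA, ← hcB]
    by_cases hleft : ∃ a ∈ A.image Prod.fst, ∃ b ∈ B.image Prod.fst, (h a).1 < (h b).1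
    · have := Hh.mixed _ _ hcell hleft
      omega
    · push Not at hleft
      have := Hh.right _ _ hcell (hA.image _) (hB.image _) fun a ha b hb =>
        (hleft a ha b hb).lt_of_ne (Hh.inj.ne fun e => Finset.disjoint_left.1 hd ha (e ▸ hb))
      omega
  · push Not at hright
    have h1 := Hh.left _ _ hcell (hA.image _) (hB.image _) fun a ha b hb => by
      obtain ⟨p, hp, rfl⟩ := Finset.mem_image.1 ha
      obtain ⟨q, hq, rfl⟩ := Finset.mem_image.1 hb
      exact (hright p hp q hq).lt_of_ne (Hh.inj.ne (hne p hp q hq))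
    have h2 := Hg.card_cup Hh Hk hAB hA
    have h3 := Hg.card_cap Hh Hk hAB hB
    omega

/-- A cell with sides of both kinds from the bundle `i`. It is a cell of this bundle, cut off by
at most two other lines; if both lines are present, or the only one cuts it off on the left, the
cell lies in a strip between two lines of the bundle. -/
lemma IsBundling.card_of_strip (Hg : IsBundling h k g x) (Hh : Tame h 3 u₁ v₁ r₁)
    (Hk : Tame k l u₂ v₂ r₂) (hAB : IsCell g A B) {i : ι} {ja jb : κ} (ha : (i, ja) ∈ A)
    (hb : (i, jb) ∈ B) : A.card + B.card ≤ max r₂ 4 + 1 := by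
  classical
  obtain ⟨τ, hτ⟩ := hAB.exists_isAbscissa
  have hfib : (fiber A i).card + (fiber B i).card ≤ max r₂ 4 := by
    have hf := Hg.isCell_fiber hAB i
    by_cases hex : ∃ a ∈ fiber A i, ∃ b ∈ fiber B i, (k a).1 < (k b).1
    · exact (Hk.mixed _ _ hf hex).trans (le_max_right _ _)
    · push Not at hex
      refine (Hk.right _ _ hf ⟨ja, mem_fiber.2 ha⟩ ⟨jb, mem_fiber.2 hb⟩ fun a ha b hb =>
        (hex a ha b hb).lt_of_ne (Hk.inj.ne fun e => ?_)).trans (le_max_left _ _)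
      exact Finset.disjoint_left.1 hf.1 ha (e ▸ hb)
  -- The lines of other bundles cut off the cell on the left or on the right.
  set cutL : ι × κ → Prop := fun w =>
    (w ∈ B ∧ (h w.1).1 < (h i).1) ∨ (w ∈ A ∧ (h i).1 < (h w.1).1) with hcutL
  set cutR : ι × κ → Prop := fun w =>
    (w ∈ A ∧ (h w.1).1 < (h i).1) ∨ (w ∈ B ∧ (h i).1 < (h w.1).1) with hcutR
  have hL : ∀ w, cutL w → (w ∈ A ∨ w ∈ B) ∧ i ≠ w.1 ∧ ∃ j j' : κ,
      (∀ z, z ∈ A ∨ z ∈ B → cross (g (i, j)) (g w) < τ z) ∧ τ w < cross (g (i, j')) (g w) := by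
    rintro w (⟨hw, hlt⟩ | ⟨hw, hlt⟩)
    · refine ⟨.inr hw, fun e => by rw [← e] at hlt; exact lt_irrefl _ hlt, ja, jb,
        fun z hz => ?_, ?_⟩
      · rw [cross_comm]; exact hτ.right ha hw hz (Hg.slope w.2 ja hlt)
      · rw [cross_comm]; exact hτ.cap_left hw hb (Hg.slope w.2 jb hlt)
    · refine ⟨.inl hw, fun e => by rw [← e] at hlt; exact lt_irrefl _ hlt, jb, ja,
        fun z hz => ?_, ?_⟩
      · exact hτ.right hw hb hz (Hg.slope jb w.2 hlt)
      · exact hτ.cup_right ha hw (Hg.slope ja w.2 hlt)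
  have hR : ∀ w, cutR w → (w ∈ A ∨ w ∈ B) ∧ i ≠ w.1 ∧ ∃ j j' : κ,
      (∀ z, z ∈ A ∨ z ∈ B → τ z < cross (g (i, j)) (g w)) ∧ cross (g (i, j')) (g w) < τ w := by
    rintro w (⟨hw, hlt⟩ | ⟨hw, hlt⟩)
    · refine ⟨.inl hw, fun e => by rw [← e] at hlt; exact lt_irrefl _ hlt, jb, ja,
        fun z hz => ?_, ?_⟩
      · rw [cross_comm]; exact hτ.left hw hb hz (Hg.slope w.2 jb hlt)
      · rw [cross_comm]; exact hτ.cup_left hw ha (Hg.slope w.2 ja hlt)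
    · refine ⟨.inr hw, fun e => by rw [← e] at hlt; exact lt_irrefl _ hlt, ja, jb,
        fun z hz => ?_, ?_⟩
      · exact hτ.left ha hw hz (Hg.slope ja w.2 hlt)
      · exact hτ.cap_right hb hw (Hg.slope jb w.2 hlt)
  have hLx : ∀ w, cutL w → ∀ z, z ∈ A ∨ z ∈ B → x < τ z := fun w hw z hz => by
    obtain ⟨-, hne, j, -, h1, -⟩ := hL w hw
    exact (Hg.cross_diff hne).trans (h1 z hz)
  have hRx : ∀ w, cutR w → x < τ w := fun w hw => by
    obtain ⟨-, hne, -, j', -, h1⟩ := hR w hw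
    exact (Hg.cross_diff hne).trans h1
  -- Two lines on the same side of the cell would have to be both the nearer one.
  have uniqL : ∀ w w', cutL w → cutL w' → w = w' := by
    intro w w' hw hw'
    obtain ⟨hm, hne, j₁, j₂, h1, h2⟩ := hL w hw
    obtain ⟨hm', hne', j₁', j₂', h1', h2'⟩ := hL w' hw'
    rcases eq_or_ne w.1 w'.1 with e | e
    · have hx := hLx w hw
      rcases hw with ⟨hw, hlt⟩ | ⟨hw, hlt⟩ <;> rcases hw' with ⟨hw', hlt'⟩ | ⟨hw', hlt'⟩
      · exact Hg.injOn_cap Hk hτ hx hw hw' e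
      · rw [e] at hlt; exact absurd hlt' hlt.not_gt
      · rw [e] at hlt; exact absurd hlt' hlt.not_gt
      · exact Hg.injOn_cup Hk hτ hx hw hw' e
    · exfalso
      rcases lt_or_gt_of_ne (Hh.cross_ne hne hne' e) with h3 | h3
      · linarith [Hg.order j₂ j₁' w.2 w'.2 hne hne' h3, h1' w hm]
      · linarith [Hg.order j₂' j₁ w'.2 w.2 hne' hne h3, h1 w' hm']
  have uniqR : ∀ w w', cutR w → cutR w' → w = w' := by
    intro w w' hw hw'
    obtain ⟨hm, hne, j₁, j₂, h1, h2⟩ := hR w hw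
    obtain ⟨hm', hne', j₁', j₂', h1', h2'⟩ := hR w' hw'
    rcases eq_or_ne w.1 w'.1 with e | e
    · by_contra hww
      have hx := hRx w hw
      have hx' := hRx w' hw'
      rcases hw with ⟨hw, hlt⟩ | ⟨hw, hlt⟩ <;> rcases hw' with ⟨hw', hlt'⟩ | ⟨hw', hlt'⟩
      · rcases Hg.slope_same Hk e hww with h3 | h3
        · linarith [Hg.cross_same e h3, hτ.cup_right hw hw' h3]
        · linarith [Hg.cross_same e.symm h3, hτ.cup_right hw' hw h3]
      · rw [e] at hlt; exact absurd hlt' hlt.not_gt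
      · rw [e] at hlt; exact absurd hlt' hlt.not_gt
      · rcases Hg.slope_same Hk e hww with h3 | h3
        · linarith [Hg.cross_same e h3, hτ.cap_left hw hw' h3]
        · linarith [Hg.cross_same e.symm h3, hτ.cap_left hw' hw h3]
    · exfalso
      rcases lt_or_gt_of_ne (Hh.cross_ne hne hne' e) with h3 | h3
      · linarith [Hg.order j₁ j₂' w.2 w'.2 hne hne' h3, h1 w' hm']
      · linarith [Hg.order j₁' j₂ w'.2 w.2 hne' hne h3, h1' w hm]
  set L := (A ∪ B).filter cutL with hLdef
  set R := (A ∪ B).filter cutR with hRdef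
  have hLcard : L.card ≤ 1 := Finset.card_le_one.2 fun w hw w' hw' =>
    uniqL w w' (Finset.mem_filter.1 hw).2 (Finset.mem_filter.1 hw').2
  have hRcard : R.card ≤ 1 := Finset.card_le_one.2 fun w hw w' hw' =>
    uniqR w w' (Finset.mem_filter.1 hw).2 (Finset.mem_filter.1 hw').2
  have hout : (A.filter fun p => ¬ p.1 = i).card + (B.filter fun p => ¬ p.1 = i).card ≤
      L.card + R.card := by
    rw [← Finset.card_union_of_disjoint (Finset.disjoint_filter_filter hAB.1)]
    refine (Finset.card_le_card fun w hw => ?_).trans (Finset.card_union_le L R)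
    simp only [Finset.mem_union, Finset.mem_filter, hLdef, hRdef] at hw ⊢
    rcases hw with ⟨hw, hne⟩ | ⟨hw, hne⟩ <;> rcases Hh.lt_or_lt hne with h1 | h1
    · exact .inr ⟨.inl hw, .inl ⟨hw, h1⟩⟩
    · exact .inl ⟨.inl hw, .inr ⟨hw, h1⟩⟩
    · exact .inl ⟨.inr hw, .inl ⟨hw, h1⟩⟩
    · exact .inr ⟨.inr hw, .inr ⟨hw, h1⟩⟩
  have hA := Finset.card_filter_add_card_filter_not (s := A) fun p => p.1 = i
  have hB := Finset.card_filter_add_card_filter_not (s := B) fun p => p.1 = i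
  rw [← card_fiber] at hA hB
  rcases L.eq_empty_or_nonempty with hLe | ⟨w, hw⟩
  · rw [hLe, Finset.card_empty] at hout
    omega
  · have hx := hLx w (Finset.mem_filter.1 hw).2
    have h1 : (fiber A i).card ≤ 1 := Finset.card_le_one.2 fun j hj j' hj' => congrArg Prod.snd
      (Hg.injOn_cup Hk hτ hx (mem_fiber.1 hj) (mem_fiber.1 hj') rfl)
    have h2 : (fiber B i).card ≤ 1 := Finset.card_le_one.2 fun j hj j' hj' => congrArg Prod.snd
      (Hg.injOn_cap Hk hτ hx (mem_fiber.1 hj) (mem_fiber.1 hj') rfl)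
    omega

/-- The size of a cell of a bundling. -/
theorem IsBundling.card_le {M : ℕ} (Hg : IsBundling h k g x) (Hh : Tame h 3 u₁ v₁ r₁)
    (Hk : Tame k l u₂ v₂ r₂) (hu : u₁ + u₂ ≤ M + 1) (hv : v₁ + v₂ ≤ M + 1) (hr₁ : r₁ ≤ M)
    (huv : u₂ + v₂ + 1 ≤ M) (hr₂ : r₂ + 1 ≤ M) (hM : 5 ≤ M) (hAB : IsCell g A B) :
    A.card + B.card ≤ M := by
  rcases A.eq_empty_or_nonempty with rfl | hA
  · rcases B.eq_empty_or_nonempty with rfl | hB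
    · simp
    have h1 := Hg.card_cap Hh Hk hAB hB
    have h2 := Hh.cap _ (Hg.isCell_image Hh hAB (by simp))
    rw [Finset.card_empty]
    omega
  rcases B.eq_empty_or_nonempty with rfl | hB
  · have h1 := Hg.card_cup Hh Hk hAB hA
    have h2 := Hh.cup _ (Hg.isCell_image Hh hAB (by simp))
    rw [Finset.card_empty]
    omega
  by_cases hd : Disjoint (A.image Prod.fst) (B.image Prod.fst)
  · have := Hg.card_of_disjoint Hh Hk hAB hA hB hd
    omega
  · obtain ⟨i, hi, hi'⟩ := Finset.not_disjoint_iff.1 hd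
    obtain ⟨⟨i, ja⟩, ha, rfl⟩ := Finset.mem_image.1 hi
    obtain ⟨⟨i', jb⟩, hb, rfl⟩ := Finset.mem_image.1 hi'
    have := Hg.card_of_strip Hh Hk hAB ha hb
    omega

end Bundling

open Filter Topology in
lemma tendsto_affine_div_affine (a b d : ℝ) {c : ℝ} (hc : c ≠ 0) :
    Tendsto (fun s : ℝ => (s * a + b) / (s * c + d)) atTop (𝓝 (a / c)) := by
  have h : ∀ a b : ℝ, Tendsto (fun s : ℝ => a + b * s⁻¹) atTop (𝓝 a) := fun a b => by
    simpa using (tendsto_inv_atTop_zero.const_mul b).const_add a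
  refine ((h a b).div (h c d) hc).congr' ?_
  filter_upwards [eventually_gt_atTop 0] with s hs
  rw [Pi.div_apply, ← mul_div_mul_left (a + b * s⁻¹) (c + d * s⁻¹) hs.ne']
  congr 1 <;> field_simp

open Filter Topology in
/-- Every line of a finite family can be replaced by a small bundle. The codes of the lines of `h`
are stretched, so that those of `k` become small in comparison, and sheared, which moves all
crossings of `h` to the right. -/
theorem exists_isBundling {ι κ : Type*} [Finite ι] [Finite κ] {h : ι → ℝ × ℝ} {k : κ → ℝ × ℝ}
    (hh : Function.Injective fun i => (h i).1) :
    ∃ g x, IsBundling h k g x := by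
  obtain ⟨x, hx⟩ := exists_forall_gt_of_finite fun p : κ × κ => cross (k p.1) (k p.2)
  obtain ⟨y, hy⟩ := exists_forall_gt_of_finite fun p : ι × ι => x - cross (h p.1) (h p.2)
  set g : ℝ → ι × κ → ℝ × ℝ := fun s p =>
    (s * (h p.1).1 + (k p.2).1, s * ((h p.1).2 - y * (h p.1).1) + (k p.2).2) with hg
  have hslope : ∀ᶠ s in atTop, ∀ i i' j j', (h i).1 < (h i').1 →
      (g s (i, j)).1 < (g s (i', j')).1 := by
    refine eventually_all.2 fun i => eventually_all.2 fun i' => eventually_all.2 fun j =>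
      eventually_all.2 fun j' => eventually_all.2 fun hlt => ?_
    filter_upwards [eventually_gt_atTop (((k j).1 - (k j').1) / ((h i').1 - (h i).1))] with s hs
    rw [div_lt_iff₀ (sub_pos.2 hlt)] at hs
    simp only [hg]
    linarith
  have hlim : ∀ {i i'} (j j'), i ≠ i' →
      Tendsto (fun s => cross (g s (i, j)) (g s (i', j'))) atTop
        (𝓝 (cross (h i) (h i') + y)) := by
    intro i i' j j' hii
    have hne : (h i').1 - (h i).1 ≠ 0 := sub_ne_zero.2 (hh.ne hii.symm)
    convert tendsto_affine_div_affine
      (((h i).2 - y * (h i).1) - ((h i').2 - y * (h i').1)) ((k j).2 - (k j').2)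
      ((k j').1 - (k j).1) hne using 2
    · simp only [hg, cross]
      congr 1 <;> ring
    · rw [cross]
      field_simp
      ring
  have hdiff : ∀ᶠ s in atTop, ∀ i i' j j', i ≠ i' → x < cross (g s (i, j)) (g s (i', j')) :=
    eventually_all.2 fun i => eventually_all.2 fun i' => eventually_all.2 fun j =>
      eventually_all.2 fun j' => eventually_all.2 fun hii =>
        (hlim j j' hii).eventually_const_lt (by linarith [hy (i, i')])
  have horder : ∀ᶠ s in atTop, ∀ i i' i'' j j₂ j' j'', i ≠ i' → i ≠ i'' →
      cross (h i) (h i') < cross (h i) (h i'') →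
        cross (g s (i, j)) (g s (i', j')) < cross (g s (i, j₂)) (g s (i'', j'')) :=
    eventually_all.2 fun i => eventually_all.2 fun i' => eventually_all.2 fun i'' =>
      eventually_all.2 fun j => eventually_all.2 fun j₂ => eventually_all.2 fun j' =>
        eventually_all.2 fun j'' => eventually_all.2 fun h1 => eventually_all.2 fun h2 =>
          eventually_all.2 fun hlt =>
            (hlim j j' h1).eventually_lt (hlim j₂ j'' h2) (by linarith)
  obtain ⟨s, h1, h2, h3⟩ := (hslope.and (hdiff.and horder)).exists
  have htr : ∀ i j, g s (i, j) = k j + (s * (h i).1, s * ((h i).2 - y * (h i).1)) := fun i j => by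
    simp only [hg, Prod.ext_iff, Prod.fst_add, Prod.snd_add]
    constructor <;> ring
  refine ⟨g s, x, fun j j' => h1 _ _ j j', fun i => ⟨_, htr i⟩, fun i j j' _ => ?_,
    fun j j' => h2 _ _ j j', fun j j₂ j' j'' => h3 _ _ _ j j₂ j' j''⟩
  rw [htr, htr, cross_add_right]
  exact hx (j, j')

/-- There is a family of `N` lines with distinct slopes, fewer than `l` of them concurrent and at
most `M` in convex position. -/
def ExistsBounded (N l M : ℕ) : Prop :=
  ∃ (ι : Type) (_ : Fintype ι) (h : ι → ℝ × ℝ), Fintype.card ι = N ∧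
    (Function.Injective fun i => (h i).1) ∧
    (∀ (G : Finset ι) (t y : ℝ), (∀ i ∈ G, height (h i) t = y) → G.card < l) ∧
    ∀ A B : Finset ι, IsCell h A B → A.card + B.card ≤ M

lemma ExistsTame.existsBounded {N l u v r M : ℕ} (H : ExistsTame N l u v r) (hu : u ≤ M)
    (hv : v ≤ M) (hr : r ≤ M) (hM : 4 ≤ M) : ExistsBounded N l M := by
  obtain ⟨ι, _, h, hN, H⟩ := H
  refine ⟨ι, _, h, hN, H.inj, H.conc, fun A B hAB => ?_⟩
  rcases A.eq_empty_or_nonempty with rfl | hA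
  · have := H.cap B hAB
    rw [Finset.card_empty]
    omega
  rcases B.eq_empty_or_nonempty with rfl | hB
  · have := H.cup A hAB
    rw [Finset.card_empty]
    omega
  by_cases hex : ∃ a ∈ A, ∃ b ∈ B, (h a).1 < (h b).1
  · exact (H.mixed A B hAB hex).trans hM
  · push Not at hex
    refine (H.right A B hAB hA hB fun a ha b hb => (hex a ha b hb).lt_of_ne
      (H.inj.ne fun e => ?_)).trans hr
    exact Finset.disjoint_left.1 hAB.1 ha (e ▸ hb)

theorem ExistsTame.existsBounded_mul {N₁ N₂ l u₁ v₁ r₁ u₂ v₂ r₂ M : ℕ}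
    (H₁ : ExistsTame N₁ 3 u₁ v₁ r₁) (H₂ : ExistsTame N₂ l u₂ v₂ r₂) (hl : 3 ≤ l)
    (hu : u₁ + u₂ ≤ M + 1) (hv : v₁ + v₂ ≤ M + 1) (hr₁ : r₁ ≤ M) (huv : u₂ + v₂ + 1 ≤ M)
    (hr₂ : r₂ + 1 ≤ M) (hM : 5 ≤ M) : ExistsBounded (N₁ * N₂) l M := by
  classical
  obtain ⟨ι, _, h, rfl, Hh⟩ := H₁
  obtain ⟨κ, _, k, rfl, Hk⟩ := H₂
  obtain ⟨g, x, Hg⟩ := exists_isBundling (k := k) Hh.inj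
  exact ⟨ι × κ, inferInstance, g, Fintype.card_prod _ _, Hg.injective Hh Hk,
    fun G t y hG => Hg.conc Hh Hk hl hG,
    fun A B hAB => Hg.card_le Hh Hk hu hv hr₁ huv hr₂ hM hAB⟩

/-! ### Large families without many lines in convex position -/

lemma choose_eq_centralBinom (p : ℕ) : (p + p + 2).choose (p + 1) = (p + 1).centralBinom := by
  rw [Nat.centralBinom_eq_two_mul_choose]
  congr 1
  ring

lemma centralBinom_succ_le (p : ℕ) : (p + 1).centralBinom ≤ 4 * p.centralBinom := by
  have h := Nat.succ_mul_centralBinom_succ p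
  have h' : (p + 1) * (p + 1).centralBinom ≤ (p + 1) * (4 * p.centralBinom) := by
    rw [h]
    calc 2 * (2 * p + 1) * p.centralBinom ≤ 2 * (2 * p + 2) * p.centralBinom := by gcongr; omega
      _ = (p + 1) * (4 * p.centralBinom) := by ring
  exact Nat.le_of_mul_le_mul_left h' p.succ_pos

lemma centralBinom_succ_eq (p : ℕ) : (p + 1).centralBinom = 2 * (2 * p + 1).choose p := by
  rw [Nat.centralBinom_eq_two_mul_choose, show 2 * (p + 1) = (2 * p + 1) + 1 by ring,
    Nat.choose_succ_succ, show (2 * p + 1).choose (p + 1) = (2 * p + 1).choose p from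
      Nat.choose_symm_half p]
  ring

/-- Three copies of a balanced family of Erdős and Szekeres, each line replaced by a bundle of the
same type. -/
theorem existsBounded_even {l : ℕ} (hl : 3 ≤ l) (p : ℕ) :
    ExistsBounded (3 * (p + 1).centralBinom *
      ((p + 1).centralBinom + (l - 3) * p.centralBinom)) l (2 * p + 5) := by
  have hX := existsTame_choose le_rfl p p
  have hY := existsTame_choose hl p p
  rw [choose_eq_centralBinom] at hX hY
  rw [← two_mul p, ← Nat.centralBinom_eq_two_mul_choose] at hX hY
  have hXX := (hX.add hX le_rfl).add hX le_rfl
  convert hXX.existsBounded_mul hY hl (M := 2 * p + 5) ?_ ?_ ?_ ?_ ?_ ?_ using 1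
  · simp; left; ring
  all_goals omega

/-- The analogue of `existsBounded_even` for an even bound; the bundles are slightly unbalanced. -/
theorem existsBounded_odd {l : ℕ} (hl : 3 ≤ l) (p : ℕ) :
    ExistsBounded (5 * (2 * p + 3).choose (p + 1) *
      ((2 * p + 3).choose (p + 1) + (l - 3) * (2 * p + 1).choose p)) l (2 * p + 6) := by
  have hX := existsTame_choose le_rfl (p + 1) (p + 1)
  have hX' := existsTame_choose le_rfl (p + 1) p
  have hY := existsTame_choose hl p (p + 1)
  rw [choose_eq_centralBinom, centralBinom_succ_eq] at hX
  have hXX := (hX.add hX' le_rfl).add hX le_rfl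
  have e1 : (p + 1 + p + 2).choose (p + 1 + 1) = (2 * p + 3).choose (p + 1) := by
    rw [← Nat.choose_symm_of_eq_add (show p + 1 + p + 2 = (p + 1) + (p + 1 + 1) by ring)]
    congr 1
    ring
  have e2 : p + (p + 1) + 2 = 2 * p + 3 := by ring
  have e3 : p + (p + 1) = 2 * p + 1 := by ring
  have e4 : 2 * (p + 1) + 1 = 2 * p + 3 := by ring
  rw [e1, e4] at hXX
  rw [e2, e3] at hY
  convert hXX.existsBounded_mul hY hl (M := 2 * p + 6) ?_ ?_ ?_ ?_ ?_ ?_ using 1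
  · simp; left; ring
  all_goals omega

theorem existsBounded_four {l : ℕ} (hl : 3 ≤ l) : ExistsBounded (2 * l) l 4 := by
  have h1 := (existsTame_pencil (l := l) (by omega)).add (existsTame_point (by omega)) hl
  have h2 := (existsTame_point (by omega)).add (existsTame_pencil (l := l) (by omega)) hl
  convert (h1.add h2 hl).existsBounded (M := 4) ?_ ?_ ?_ ?_ using 1
  all_goals omega

/-! ### Cells as connected components -/

/-- The line coded by `p`. -/
def lineSet (p : ℝ × ℝ) : Set (ℝ × ℝ) := {q | q.2 = p.1 * q.1 + p.2}

lemma mem_lineSet {p q : ℝ × ℝ} : q ∈ lineSet p ↔ q.2 = height p q.1 := Iff.rfl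

lemma lineSet_injective : Function.Injective lineSet := by
  intro p q hpq
  have h0 : ((0 : ℝ), p.2) ∈ lineSet q := hpq ▸ by simp [lineSet]
  have h1 : ((1 : ℝ), p.1 + p.2) ∈ lineSet q := hpq ▸ by simp [lineSet]
  simp only [lineSet, Set.mem_ofPred_eq] at h0 h1
  exact Prod.ext (by linarith) (by linarith)

lemma continuous_height_fst (p : ℝ × ℝ) : Continuous fun q : ℝ × ℝ => height p q.1 := by
  unfold height
  fun_prop

/-- The points below the lines of `A` and above the lines of `B`. -/
def region {ι : Type*} (h : ι → ℝ × ℝ) (A B : Finset ι) : Set (ℝ × ℝ) :=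
  {q | (∀ a ∈ A, q.2 < height (h a) q.1) ∧ ∀ b ∈ B, height (h b) q.1 < q.2}

section Region

variable {ι : Type*} {h : ι → ℝ × ℝ} {A B : Finset ι}

lemma isOpen_region : IsOpen (region h A B) := by
  have e : region h A B = (⋂ a ∈ A, {q : ℝ × ℝ | q.2 < height (h a) q.1}) ∩
      ⋂ b ∈ B, {q : ℝ × ℝ | height (h b) q.1 < q.2} := by
    ext q
    simp [region]
  rw [e]
  exact (isOpen_biInter_finset fun a _ => isOpen_lt continuous_snd (continuous_height_fst _)).inter
    (isOpen_biInter_finset fun b _ => isOpen_lt (continuous_height_fst _) continuous_snd)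

lemma convex_region : Convex ℝ (region h A B) := by
  have key : ∀ {x y a b : ℝ}, 0 < x → 0 < y → 0 ≤ a → 0 ≤ b → a + b = 1 → 0 < a * x + b * y :=
    fun hx hy ha hb hab => convex_Ioi (0 : ℝ) hx hy ha hb hab
  intro q hq q' hq' a b ha hb hab
  refine ⟨fun i hi => ?_, fun i hi => ?_⟩
  · have h1 := hq.1 i hi
    have h2 := hq'.1 i hi
    have h3 := key (sub_pos.2 h1) (sub_pos.2 h2) ha hb hab
    simp only [height, Prod.fst_add, Prod.snd_add, Prod.smul_fst, Prod.smul_snd,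
      smul_eq_mul] at h3 ⊢
    obtain rfl : b = 1 - a := by linarith
    linarith
  · have h1 := hq.2 i hi
    have h2 := hq'.2 i hi
    have h3 := key (sub_pos.2 h1) (sub_pos.2 h2) ha hb hab
    simp only [height, Prod.fst_add, Prod.snd_add, Prod.smul_fst, Prod.smul_snd,
      smul_eq_mul] at h3 ⊢
    obtain rfl : b = 1 - a := by linarith
    linarith

lemma mem_compl_iUnion_image [DecidableEq ι] {S : Finset ι} {q : ℝ × ℝ} :
    q ∈ (⋃ L ∈ S.image fun i => lineSet (h i), L)ᶜ ↔ ∀ i ∈ S, q.2 ≠ height (h i) q.1 := by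
  simp [mem_lineSet]

lemma connectedComponentIn_eq_region [DecidableEq ι] {x : ℝ × ℝ} (hx : x ∈ region h A B) :
    connectedComponentIn (⋃ L ∈ (A ∪ B).image fun i => lineSet (h i), L)ᶜ x = region h A B := by
  have hsub : region h A B ⊆ (⋃ L ∈ (A ∪ B).image fun i => lineSet (h i), L)ᶜ := by
    intro q hq
    refine mem_compl_iUnion_image.2 fun i hi => ?_
    rcases Finset.mem_union.1 hi with hi | hi
    · exact (hq.1 i hi).ne
    · exact (hq.2 i hi).ne'
  refine Set.Subset.antisymm (fun q hq => ?_)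
    (convex_region.isPreconnected.subset_connectedComponentIn hx hsub)
  have hxm := mem_connectedComponentIn (hsub hx)
  have hpre := isPreconnected_connectedComponentIn (x := x)
    (F := (⋃ L ∈ (A ∪ B).image fun i => lineSet (h i), L)ᶜ)
  have hcont : ∀ i, Continuous fun q : ℝ × ℝ => height (h i) q.1 - q.2 := fun i =>
    (continuous_height_fst _).sub continuous_snd
  refine ⟨fun a ha => ?_, fun b hb => ?_⟩
  · by_contra! hle
    obtain ⟨y, hy, h0⟩ := hpre.intermediate_value hq hxm (hcont a).continuousOn
      ⟨sub_nonpos.2 hle, (sub_pos.2 (hx.1 a ha)).le⟩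
    exact mem_compl_iUnion_image.1 (connectedComponentIn_subset _ _ hy) a
      (Finset.mem_union_left _ ha) (sub_eq_zero.1 h0).symm
  · by_contra! hle
    obtain ⟨y, hy, h0⟩ := hpre.intermediate_value hxm hq (hcont b).continuousOn
      ⟨(sub_neg.2 (hx.2 b hb)).le, sub_nonneg.2 hle⟩
    exact mem_compl_iUnion_image.1 (connectedComponentIn_subset _ _ hy) b
      (Finset.mem_union_right _ hb) (sub_eq_zero.1 h0).symm

lemma closure_region_subset : closure (region h A B) ⊆
    {q | (∀ a ∈ A, q.2 ≤ height (h a) q.1) ∧ ∀ b ∈ B, height (h b) q.1 ≤ q.2} := by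
  refine closure_minimal (fun q hq => ⟨fun a ha => (hq.1 a ha).le, fun b hb => (hq.2 b hb).le⟩) ?_
  have e : {q : ℝ × ℝ | (∀ a ∈ A, q.2 ≤ height (h a) q.1) ∧ ∀ b ∈ B, height (h b) q.1 ≤ q.2} =
      (⋂ a ∈ A, {q : ℝ × ℝ | q.2 ≤ height (h a) q.1}) ∩
        ⋂ b ∈ B, {q : ℝ × ℝ | height (h b) q.1 ≤ q.2} := by
    ext q
    simp
  rw [e]
  exact (isClosed_biInter fun a _ => isClosed_le continuous_snd (continuous_height_fst _)).inter
    (isClosed_biInter fun b _ => isClosed_le (continuous_height_fst _) continuous_snd)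

/-- Lines in convex position are the sides of a cell. -/
theorem exists_isCell_of_inConvexPosition [DecidableEq ι] (hinj : Function.Injective fun i => (h i).1)
    {S : Finset ι} (H : InConvexPosition (S.image fun i => lineSet (h i))) :
    ∃ A B, IsCell h A B ∧ A.card + B.card = S.card := by
  obtain ⟨P, ⟨x, hx, rfl⟩, hcard⟩ := H
  have hcontr : ∀ i ∈ S, ContributesSegment (connectedComponentIn
      (⋃ L ∈ S.image fun i => lineSet (h i), L)ᶜ x) (lineSet (h i)) := by
    intro i hi
    rw [← Set.ncard_coe_finset] at hcard
    have := Set.eq_of_subset_of_ncard_le (fun L hL => hL.1) hcard.ge (Finset.finite_toSet _)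
    have hmem : lineSet (h i) ∈ (↑(S.image fun i => lineSet (h i)) : Set (Set (ℝ × ℝ))) :=
      Finset.mem_coe.2 (Finset.mem_image_of_mem _ hi)
    rw [← this] at hmem
    exact hmem.2
  rw [mem_compl_iUnion_image] at hx
  set A := S.filter fun i => x.2 < height (h i) x.1 with hA
  set B := S.filter fun i => ¬ x.2 < height (h i) x.1 with hB
  have hS : A ∪ B = S := Finset.filter_union_filter_not_eq _ S
  have hdisj : Disjoint A B := Finset.disjoint_filter_filter_not S S _
  have hxr : x ∈ region h A B := by
    refine ⟨fun a ha => (Finset.mem_filter.1 ha).2, fun b hb => ?_⟩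
    have hb := Finset.mem_filter.1 hb
    exact (not_lt.1 hb.2).lt_of_ne (hx b hb.1).symm
  have hcomp := connectedComponentIn_eq_region hxr
  rw [hS] at hcomp
  rw [hcomp] at hcontr
  refine ⟨A, B, ⟨hdisj, fun z hz => ?_⟩, by rw [← Finset.card_union_of_disjoint hdisj, hS]⟩
  have hzS : z ∈ S := by rw [← hS]; exact Finset.mem_union.2 hz
  obtain ⟨p, q, hpq, hseg⟩ := hcontr z hzS
  have hp := (hseg (left_mem_segment ℝ p q)).1
  have hq := (hseg (right_mem_segment ℝ p q)).1
  have hpq1 : q.1 - p.1 ≠ 0 := fun e => hpq (Prod.ext (sub_eq_zero.1 e).symm (by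
    rw [mem_lineSet] at hp hq
    rw [hp, hq, sub_eq_zero.1 e]))
  -- A point of the segment that is on no other line.
  obtain ⟨s, hs, hsT⟩ := (Set.Ioo_infinite (zero_lt_one (α := ℝ))).exists_notMem_finset
    (S.image fun w => (cross (h w) (h z) - p.1) / (q.1 - p.1))
  set y : ℝ × ℝ := (1 - s) • p + s • q with hy
  have hyseg : y ∈ segment ℝ p q :=
    ⟨1 - s, s, by linarith [hs.2], hs.1.le, by ring, rfl⟩
  have hy1 : y.1 = p.1 + s * (q.1 - p.1) := by
    simp only [hy, Prod.fst_add, Prod.smul_fst, smul_eq_mul]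
    ring
  obtain ⟨hyL, hyf⟩ := hseg hyseg
  rw [mem_lineSet] at hyL
  have hcl := closure_region_subset (frontier_subset_closure hyf)
  have hne : ∀ w ∈ S, w ≠ z → height (h w) y.1 ≠ height (h z) y.1 := by
    intro w hw hwz e
    rw [height_eq_iff (hinj.ne hwz)] at e
    refine hsT (Finset.mem_image.2 ⟨w, hw, ?_⟩)
    rw [← e, hy1]
    field_simp
    ring
  refine ⟨y.1, fun a ha haz => ?_, fun b hb hbz => ?_⟩
  · have := hcl.1 a ha
    rw [hyL] at this
    exact this.lt_of_ne (hne a (Finset.mem_filter.1 ha).1 haz).symm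
  · have := hcl.2 b hb
    rw [hyL] at this
    exact this.lt_of_ne (hne b (Finset.mem_filter.1 hb).1 hbz)

open Filter Topology in
lemma IsCell.mem_frontier (hd : Disjoint A B) {z : ι} (hz : z ∈ A ∨ z ∈ B) {t : ℝ}
    (h1 : ∀ a ∈ A, a ≠ z → height (h z) t < height (h a) t)
    (h2 : ∀ b ∈ B, b ≠ z → height (h b) t < height (h z) t) :
    (t, height (h z) t) ∈ frontier (region h A B) := by
  rw [isOpen_region.frontier_eq]
  refine ⟨?_, fun hr => hz.elim (fun hz => (hr.1 z hz).false) fun hz => (hr.2 z hz).false⟩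
  obtain ⟨σ, hσA, hσB⟩ : ∃ σ : ℝ, (z ∈ A → σ = 1) ∧ (z ∈ B → σ = -1) := by
    rcases hz with hz | hz
    · exact ⟨1, fun _ => rfl, fun h => (Finset.disjoint_left.1 hd hz h).elim⟩
    · exact ⟨-1, fun h => (Finset.disjoint_left.1 hd h hz).elim, fun _ => rfl⟩
  have hcont : Tendsto (fun ε : ℝ => height (h z) t - σ * ε) (𝓝[>] 0) (𝓝 (height (h z) t)) := by
    have : Continuous fun ε : ℝ => height (h z) t - σ * ε := by fun_prop
    simpa using (this.tendsto 0).mono_left nhdsWithin_le_nhds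
  refine mem_closure_of_tendsto (tendsto_const_nhds.prodMk_nhds hcont) ?_
  refine .and ?_ ?_
  · refine (eventually_all_finset A).2 fun a ha => ?_
    rcases eq_or_ne a z with rfl | haz
    · filter_upwards [self_mem_nhdsWithin] with ε hε
      rw [hσA ha]
      have hε : 0 < ε := hε
      linarith
    · exact hcont.eventually_lt_const (h1 a ha haz)
  · refine (eventually_all_finset B).2 fun b hb => ?_
    rcases eq_or_ne b z with rfl | hbz
    · filter_upwards [self_mem_nhdsWithin] with ε hε
      rw [hσB hb]
      have hε : 0 < ε := hε
      linarith
    · exact hcont.eventually_const_lt (h2 b hb hbz)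

open Filter Topology in
/-- The sides of a cell are in convex position. -/
theorem IsCell.inConvexPosition [DecidableEq ι] (hAB : IsCell h A B) (hne : (A ∪ B).Nonempty) :
    InConvexPosition ((A ∪ B).image fun i => lineSet (h i)) := by
  have hreg : (region h A B).Nonempty := by
    obtain ⟨z, hz⟩ := hne
    obtain ⟨t, h1, h2⟩ := hAB.2 z (Finset.mem_union.1 hz)
    exact closure_nonempty_iff.1
      ⟨_, frontier_subset_closure (IsCell.mem_frontier hAB.1 (Finset.mem_union.1 hz) h1 h2)⟩
  obtain ⟨x, hx⟩ := hreg
  refine ⟨region h A B, ⟨x, ?_, (connectedComponentIn_eq_region hx).symm⟩, ?_⟩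
  · refine connectedComponentIn_subset _ x ?_
    rw [connectedComponentIn_eq_region hx]
    exact hx
  rw [← Set.ncard_coe_finset]
  congr 1
  ext L
  refine ⟨fun hL => hL.1, fun hL => ⟨hL, ?_⟩⟩
  obtain ⟨z, hz, rfl⟩ := Finset.mem_image.1 hL
  rw [Finset.mem_union] at hz
  obtain ⟨t, h1, h2⟩ := hAB.2 z hz
  have hc : ∀ i, Continuous (height (h i)) := fun i => by
    unfold height
    fun_prop
  have hev : ∀ᶠ s in 𝓝 t, (∀ a ∈ A, a ≠ z → height (h z) s < height (h a) s) ∧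
      ∀ b ∈ B, b ≠ z → height (h b) s < height (h z) s :=
    ((eventually_all_finset A).2 fun a ha => eventually_all.2 fun haz =>
      (hc z).continuousAt.eventually_lt (hc a).continuousAt (h1 a ha haz)).and
    ((eventually_all_finset B).2 fun b hb => eventually_all.2 fun hbz =>
      (hc b).continuousAt.eventually_lt (hc z).continuousAt (h2 b hb hbz))
  obtain ⟨δ, hδ, hball⟩ := Metric.eventually_nhds_iff.1 hev
  refine ⟨(t, height (h z) t), (t + δ / 2, height (h z) (t + δ / 2)), fun e => ?_, ?_⟩
  · have := congrArg Prod.fst e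
    simp only at this
    linarith
  · rintro q ⟨a, b, ha, hb, hab, rfl⟩
    obtain rfl : a = 1 - b := by linarith
    have e : (1 - b) • (t, height (h z) t) + b • (t + δ / 2, height (h z) (t + δ / 2)) =
        (t + b * (δ / 2), height (h z) (t + b * (δ / 2))) := by
      simp only [height, Prod.smul_mk, Prod.mk_add_mk, smul_eq_mul, Prod.mk.injEq]
      constructor <;> ring
    rw [e]
    obtain ⟨h3, h4⟩ := hball (y := t + b * (δ / 2)) (by
      rw [Real.dist_eq, add_sub_cancel_left, abs_of_nonneg (by positivity)]
      nlinarith)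
    exact ⟨rfl, IsCell.mem_frontier hAB.1 hz h3 h4⟩

end Region

/-! ### Large families contain concurrent lines or lines in convex position -/

lemma cross_lt_cross_lt {p q s : ℝ × ℝ} (hpq : p.1 < q.1) (hqs : q.1 < s.1)
    (h : cross p q < cross q s) : cross p q < cross p s ∧ cross p s < cross q s := by
  have h1 := (height_eq_iff hpq.ne _).2 (rfl : cross p q = cross p q)
  have h2 := (height_eq_iff hqs.ne _).2 (rfl : cross q s = cross q s)
  rw [← lt_height_iff (hpq.trans hqs), ← height_lt_iff (hpq.trans hqs), h1, ← h2]
  exact ⟨(lt_height_iff hqs _).2 h, (height_lt_iff hpq _).2 h⟩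

lemma cross_gt_cross_gt {p q s : ℝ × ℝ} (hpq : p.1 < q.1) (hqs : q.1 < s.1)
    (h : cross q s < cross p q) : cross q s < cross p s ∧ cross p s < cross p q := by
  have h1 := (height_eq_iff hpq.ne _).2 (rfl : cross p q = cross p q)
  have h2 := (height_eq_iff hqs.ne _).2 (rfl : cross q s = cross q s)
  rw [← lt_height_iff (hpq.trans hqs), ← height_lt_iff (hpq.trans hqs), h1, ← h2]
  exact ⟨(lt_height_iff hpq _).2 h, (height_lt_iff hqs _).2 h⟩

section ErdosSzekeres

variable {ι : Type*} {h : ι → ℝ × ℝ}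

/-- Consecutive crossings of the lines of `A`, in the order of slopes, move to the left. -/
def IsCup (h : ι → ℝ × ℝ) (A : Finset ι) : Prop :=
  ∀ x ∈ A, ∀ y ∈ A, ∀ z ∈ A, (h x).1 < (h y).1 → (h y).1 < (h z).1 →
    cross (h y) (h z) < cross (h x) (h y)

/-- Consecutive crossings of the lines of `A`, in the order of slopes, move to the right. -/
def IsCap (h : ι → ℝ × ℝ) (A : Finset ι) : Prop :=
  ∀ x ∈ A, ∀ y ∈ A, ∀ z ∈ A, (h x).1 < (h y).1 → (h y).1 < (h z).1 →
    cross (h x) (h y) < cross (h y) (h z)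

/-- Fewer than `l` lines of `S` are concurrent. -/
def NoConcurrent (h : ι → ℝ × ℝ) (l : ℕ) (S : Finset ι) : Prop :=
  ∀ G ⊆ S, ∀ t y : ℝ, (∀ i ∈ G, height (h i) t = y) → G.card < l

lemma NoConcurrent.mono {l : ℕ} {S T : Finset ι} (H : NoConcurrent h l T) (hST : S ⊆ T) :
    NoConcurrent h l S := fun G hG => H G (hG.trans hST)

lemma NoConcurrent.cross_ne [DecidableEq ι] {S : Finset ι} (H : NoConcurrent h 3 S) {x y z : ι}
    (hx : x ∈ S) (hy : y ∈ S) (hz : z ∈ S) (hxy : (h x).1 < (h y).1) (hyz : (h y).1 < (h z).1) :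
    cross (h x) (h y) ≠ cross (h y) (h z) := by
  intro e
  have h1 := (height_eq_iff hxy.ne (cross (h x) (h y))).2 rfl
  have h2 := (height_eq_iff hyz.ne (cross (h x) (h y))).2 e
  have := H {x, y, z} (by simp [Finset.insert_subset_iff, hx, hy, hz]) (cross (h x) (h y))
    (height (h y) (cross (h x) (h y))) (by simp [h1, ← h2])
  have hne : ∀ {i j}, (h i).1 < (h j).1 → i ≠ j := fun hij e => by simp [e] at hij
  rw [Finset.card_eq_three.2 ⟨x, y, z, hne hxy, hne (hxy.trans hyz), hne hyz, rfl⟩] at this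
  exact lt_irrefl _ this

lemma IsCup.isCell [DecidableEq ι] {A : Finset ι} (hinj : Function.Injective fun i => (h i).1)
    (hA : IsCup h A) : IsCell h A ∅ := by
  refine IsCell.of_pairs hinj (Finset.disjoint_empty_right _) fun z hz w hw w' hw' hwz hwz' _ => ?_
  simp only [Finset.union_empty] at hz hw hw'
  simp only [hw, hw', decide_true, side_iff true (hinj.ne hwz.symm),
    side_iff true (hinj.ne hwz'.symm), true_eq_decide_iff]
  split_ifs with h1 h2 h2
  · exact (Filter.eventually_gt_atTop _ |>.and (Filter.eventually_gt_atTop _)).exists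
  · refine exists_between ?_
    rw [cross_comm (h z) (h w')]
    exact hA w' hw' z hz w hw ((not_lt.1 h2).lt_of_ne (hinj.ne hwz')) h1
  · obtain ⟨t, ht, ht'⟩ := exists_between
      (hA w hw z hz w' hw' ((not_lt.1 h1).lt_of_ne (hinj.ne hwz)) h2)
    exact ⟨t, by rwa [cross_comm (h z) (h w)], ht⟩
  · exact (Filter.eventually_lt_atBot _ |>.and (Filter.eventually_lt_atBot _)).exists

lemma IsCap.isCell [DecidableEq ι] {A : Finset ι} (hinj : Function.Injective fun i => (h i).1)
    (hA : IsCap h A) : IsCell h ∅ A := by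
  refine IsCell.of_pairs hinj (Finset.disjoint_empty_left _) fun z hz w hw w' hw' hwz hwz' _ => ?_
  simp only [Finset.empty_union] at hz hw hw'
  simp only [Finset.notMem_empty, decide_false, side_iff false (hinj.ne hwz.symm),
    side_iff false (hinj.ne hwz'.symm), false_eq_decide_iff]
  split_ifs with h1 h2 h2
  · exact (Filter.eventually_lt_atBot _ |>.and (Filter.eventually_lt_atBot _)).exists
  · obtain ⟨t, ht, ht'⟩ := exists_between
      (hA w' hw' z hz w hw ((not_lt.1 h2).lt_of_ne (hinj.ne hwz')) h1)
    exact ⟨t, ht', by rwa [cross_comm (h z) (h w')]⟩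
  · refine exists_between ?_
    rw [cross_comm (h z) (h w)]
    exact hA w hw z hz w' hw' ((not_lt.1 h1).lt_of_ne (hinj.ne hwz)) h2
  · exact (Filter.eventually_gt_atTop _ |>.and (Filter.eventually_gt_atTop _)).exists

/-- The step in the proof of the theorem of Erdős and Szekeres: a cup `C` that ends where a cap `D`
begins can be extended by an element of `D`, or `D` by an element of `C`. -/
lemma exists_cup_or_cap_of_join [DecidableEq ι] {S C D : Finset ι} {c : ι}
    (hinj : Function.Injective fun i => (h i).1) (hS : NoConcurrent h 3 S) (hCS : C ⊆ S)
    (hDS : D ⊆ S) (hC : IsCup h C) (hD : IsCap h D) (hcC : c ∈ C) (hcD : c ∈ D)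
    (hmax : ∀ x ∈ C, (h x).1 ≤ (h c).1) (hmin : ∀ y ∈ D, (h c).1 ≤ (h y).1)
    (hD1 : 1 < D.card) :
    (∃ A ⊆ S, A.card = C.card + 1 ∧ IsCup h A) ∨ ∃ B ⊆ S, B.card = D.card + 1 ∧ IsCap h B := by
  have hCc : ∀ x ∈ C, x ≠ c → (h x).1 < (h c).1 := fun x hx hxc =>
    (hmax x hx).lt_of_ne (hinj.ne hxc)
  have hDc : ∀ y ∈ D, y ≠ c → (h c).1 < (h y).1 := fun y hy hyc =>
    (hmin y hy).lt_of_ne (hinj.ne hyc.symm)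
  by_cases hex : ∃ x ∈ C, x ≠ c ∧ ∀ y ∈ D, y ≠ c → cross (h x) (h c) < cross (h c) (h y)
  · right
    obtain ⟨x, hx, hxc, hxD⟩ := hex
    have hxlt : ∀ y ∈ D, (h x).1 < (h y).1 := fun y hy => (hCc x hx hxc).trans_le (hmin y hy)
    have hxmem : x ∉ D := fun hxD => (hxlt x hxD).false
    refine ⟨insert x D, Finset.insert_subset (hCS hx) hDS, Finset.card_insert_of_notMem hxmem, ?_⟩
    intro a ha y hy z hz hay hyz
    have hD' : ∀ w, (h x).1 < (h w).1 → w ∈ insert x D → w ∈ D := fun w hw hw' =>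
      (Finset.mem_insert.1 hw').resolve_left fun e => by simp [e] at hw
    rcases Finset.mem_insert.1 ha with rfl | ha
    · have hy := hD' y hay hy
      have hz := hD' z (hay.trans hyz) hz
      rcases eq_or_ne y c with rfl | hyc
      · exact hxD z hz fun e => by simp [e] at hyz
      · have h1 := hDc y hy hyc
        exact (cross_lt_cross_lt (hCc a hx hxc) h1 (hxD y hy hyc)).2.trans
          (hD c hcD y hy z hz h1 hyz)
    · have hxa := hxlt a ha
      exact hD a ha y (hD' y (hxa.trans hay) hy) z (hD' z (hxa.trans (hay.trans hyz)) hz) hay hyz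
  · left
    push Not at hex
    obtain ⟨y, hy, hymin⟩ := Finset.exists_min_image (D.erase c) (fun y => cross (h c) (h y))
      (Finset.card_pos.1 (by rw [Finset.card_erase_of_mem hcD]; omega))
    obtain ⟨hyc, hyD⟩ := Finset.mem_erase.1 hy
    have hcy := hDc y hyD hyc
    have hlt : ∀ x ∈ C, x ≠ c → cross (h c) (h y) < cross (h x) (h c) := by
      intro x hx hxc
      obtain ⟨y', hy', hyc', hle⟩ := hex x hx hxc
      exact ((hymin y' (Finset.mem_erase.2 ⟨hyc', hy'⟩)).trans hle).lt_of_ne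
        (hS.cross_ne (hCS hx) (hCS hcC) (hDS hyD) (hCc x hx hxc) hcy).symm
    have hylt : ∀ x ∈ C, (h x).1 < (h y).1 := fun x hx => (hmax x hx).trans_lt hcy
    have hymem : y ∉ C := fun hyC => (hylt y hyC).false
    refine ⟨insert y C, Finset.insert_subset (hDS hyD) hCS, Finset.card_insert_of_notMem hymem, ?_⟩
    intro a ha b hb z hz hab hbz
    have hC' : ∀ w, (h w).1 < (h y).1 → w ∈ insert y C → w ∈ C := fun w hw hw' =>
      (Finset.mem_insert.1 hw').resolve_left fun e => by simp [e] at hw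
    rcases Finset.mem_insert.1 hz with rfl | hz
    · have ha := hC' a (hab.trans hbz) ha
      have hb := hC' b hbz hb
      rcases eq_or_ne b c with rfl | hbc
      · exact hlt a ha fun e => by simp [e] at hab
      · have h1 := hCc b hb hbc
        exact (cross_gt_cross_gt h1 hcy (hlt b hb hbc)).2.trans (hC a ha b hb c hcC hab h1)
    · have hzy := hylt z hz
      exact hC a (hC' a (hab.trans (hbz.trans hzy)) ha) b (hC' b (hbz.trans hzy) hb) z hz hab hbz

/-- The theorem of Erdős and Szekeres on cups and caps. -/
theorem exists_cup_or_cap : ∀ p q : ℕ, ∃ N : ℕ, ∀ (ι : Type) [DecidableEq ι] (h : ι → ℝ × ℝ),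
    (Function.Injective fun i => (h i).1) → ∀ S : Finset ι, NoConcurrent h 3 S → N ≤ S.card →
      (∃ A ⊆ S, A.card = p + 2 ∧ IsCup h A) ∨ ∃ B ⊆ S, B.card = q + 2 ∧ IsCap h B
  | 0, q => by
    refine ⟨2, fun ι _ h _ S _ hcard => .inl ?_⟩
    obtain ⟨A, hAS, hA⟩ := Finset.exists_subset_card_eq hcard
    refine ⟨A, hAS, hA, fun x hx y hy z hz hxy hyz => ?_⟩
    have hne : ∀ {i j}, (h i).1 < (h j).1 → i ≠ j := fun hij e => by simp [e] at hij
    have := Finset.two_lt_card.2 ⟨x, hx, y, hy, z, hz, hne hxy, hne (hxy.trans hyz), hne hyz⟩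
    omega
  | p + 1, 0 => by
    refine ⟨2, fun ι _ h _ S _ hcard => .inr ?_⟩
    obtain ⟨A, hAS, hA⟩ := Finset.exists_subset_card_eq hcard
    refine ⟨A, hAS, hA, fun x hx y hy z hz hxy hyz => ?_⟩
    have hne : ∀ {i j}, (h i).1 < (h j).1 → i ≠ j := fun hij e => by simp [e] at hij
    have := Finset.two_lt_card.2 ⟨x, hx, y, hy, z, hz, hne hxy, hne (hxy.trans hyz), hne hyz⟩
    omega
  | p + 1, q + 1 => by
    obtain ⟨N₁, h₁⟩ := exists_cup_or_cap p (q + 1)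
    obtain ⟨N₂, h₂⟩ := exists_cup_or_cap (p + 1) q
    refine ⟨N₁ + N₂, fun ι _ h hinj S hS hcard => ?_⟩
    classical
    -- The elements of `S` that are the last element of a cup with `p + 2` elements.
    set T := S.filter fun c => ∃ C ⊆ S, C.card = p + 2 ∧ IsCup h C ∧ c ∈ C ∧
      ∀ x ∈ C, (h x).1 ≤ (h c).1 with hT
    have hTS : T ⊆ S := Finset.filter_subset _ _
    have hsplit := Finset.card_sdiff_add_card_eq_card hTS
    rcases le_or_gt N₁ (S \ T).card with hN | hN
    · rcases h₁ ι h hinj (S \ T) (hS.mono Finset.sdiff_subset) hN with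
        ⟨C, hCS, hCcard, hC⟩ | ⟨B, hBS, hB⟩
      · obtain ⟨c, hc, hmax⟩ := Finset.exists_max_image C (fun i => (h i).1)
          (Finset.card_pos.1 (by omega))
        have := Finset.mem_sdiff.1 (hCS hc)
        exact absurd (Finset.mem_filter.2 ⟨this.1, C, hCS.trans Finset.sdiff_subset, hCcard, hC,
          hc, hmax⟩) this.2
      · exact .inr ⟨B, hBS.trans Finset.sdiff_subset, hB⟩
    · rcases h₂ ι h hinj T (hS.mono hTS) (by omega) with ⟨A, hAT, hA⟩ | ⟨D, hDT, hDcard, hD⟩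
      · exact .inl ⟨A, hAT.trans hTS, hA⟩
      · obtain ⟨c, hc, hmin⟩ := Finset.exists_min_image D (fun i => (h i).1)
          (Finset.card_pos.1 (by omega))
        obtain ⟨-, C, hCS, hCcard, hC, hcC, hmax⟩ := Finset.mem_filter.1 (hDT hc)
        have := exists_cup_or_cap_of_join hinj hS hCS (hDT.trans hTS) hC hD hcC hc hmax hmin
          (by omega)
        rwa [hCcard, hDcard] at this

/-- A large set of lines without `l` concurrent ones contains a large set without three concurrent
lines: if a set `T` of the latter kind is maximal, every other line passes through a crossing of
two lines of `T`. -/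
lemma exists_noConcurrent_three {l : ℕ} [DecidableEq ι] {S : Finset ι}
    (hinj : Function.Injective fun i => (h i).1) (hS : NoConcurrent h l S) {n : ℕ}
    (hcard : n + n * n * l ≤ S.card) : ∃ T ⊆ S, n ≤ T.card ∧ NoConcurrent h 3 T := by
  classical
  obtain ⟨T, hT, hmax⟩ := Finset.exists_max_image (S.powerset.filter (NoConcurrent h 3))
    Finset.card ⟨∅, Finset.mem_filter.2 ⟨Finset.empty_mem_powerset _, fun G hG _ _ _ => by
      rw [Finset.subset_empty.1 hG]; simp⟩⟩
  obtain ⟨hTS, hT3⟩ := Finset.mem_filter.1 hT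
  rw [Finset.mem_powerset] at hTS
  refine ⟨T, hTS, ?_, hT3⟩
  by_contra! hlt
  have hcover : S ⊆ T ∪ (T ×ˢ T).biUnion fun p => S.filter fun s =>
      height (h s) (cross (h p.1) (h p.2)) = height (h p.1) (cross (h p.1) (h p.2)) := by
    intro s hs
    by_cases hsT : s ∈ T
    · exact Finset.mem_union_left _ hsT
    have hnot : ¬ NoConcurrent h 3 (insert s T) := fun hc => by
      have := hmax (insert s T) (Finset.mem_filter.2
        ⟨Finset.mem_powerset.2 (Finset.insert_subset hs hTS), hc⟩)
      rw [Finset.card_insert_of_notMem hsT] at this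
      omega
    unfold NoConcurrent at hnot
    push Not at hnot
    obtain ⟨G, hG, t, y, hGy, hG3⟩ := hnot
    have hsG : s ∈ G := by
      by_contra hsG
      have := hT3 G (fun i hi => (Finset.mem_insert.1 (hG hi)).resolve_left
        fun e => hsG (e ▸ hi)) t y hGy
      omega
    obtain ⟨p, hp, q, hq, hpq⟩ := Finset.one_lt_card.1
      (by rw [Finset.card_erase_of_mem hsG]; omega : 1 < (G.erase s).card)
    have hmem : ∀ i ∈ G.erase s, i ∈ T := fun i hi =>
      (Finset.mem_insert.1 (hG (Finset.mem_of_mem_erase hi))).resolve_left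
        (Finset.ne_of_mem_erase hi)
    have hpy := hGy p (Finset.mem_of_mem_erase hp)
    have hqy := hGy q (Finset.mem_of_mem_erase hq)
    have ht := (height_eq_iff (hinj.ne hpq) t).1 (hpy.trans hqy.symm)
    refine Finset.mem_union_right _ (Finset.mem_biUnion.2 ⟨(p, q),
      Finset.mem_product.2 ⟨hmem p hp, hmem q hq⟩, Finset.mem_filter.2 ⟨hs, ?_⟩⟩)
    rw [← ht, hGy s hsG, hpy]
  have h1 := (Finset.card_le_card hcover).trans (Finset.card_union_le _ _)
  have h2 : ((T ×ˢ T).biUnion fun p => S.filter fun s => height (h s) (cross (h p.1) (h p.2)) =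
      height (h p.1) (cross (h p.1) (h p.2))).card ≤ (T ×ˢ T).card * l :=
    Finset.card_biUnion_le_card_mul _ _ _ fun p _ =>
      (hS _ (Finset.filter_subset _ _) _ _ fun i hi => (Finset.mem_filter.1 hi).2).le
  rw [Finset.card_product] at h2
  have h3 : T.card * T.card * l ≤ n * n * l := by gcongr
  omega

end ErdosSzekeres

/-- Some number of lines forces concurrent lines or lines in convex position. -/
theorem exists_forcesConcurrentOrConvex (l n : ℕ) (hn : 2 ≤ n) :
    ∃ N, ForcesConcurrentOrConvex l n N := by
  classical
  obtain ⟨p, rfl⟩ := Nat.exists_eq_add_of_le' hn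
  obtain ⟨N, hN⟩ := exists_cup_or_cap p p
  refine ⟨N + N * N * l, fun F hF hcard => ?_⟩
  have hcode : ∀ L : F, ∃ c : ℝ × ℝ, lineSet c = L.1 := fun L => by
    obtain ⟨m, c, hL⟩ := hF.1 L.1 L.2
    exact ⟨(m, c), hL.symm⟩
  choose h hh using hcode
  have hinj : Function.Injective fun i => (h i).1 := by
    intro i j hij
    by_contra hne
    obtain ⟨q, hqi, hqj⟩ := hF.2 i.1 i.2 j.1 j.2 fun e => hne (Subtype.ext e)
    rw [← hh, mem_lineSet, height] at hqi hqj
    simp only at hij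
    have e : h i = h j := Prod.ext hij (by rw [hqj, hij] at hqi; linarith)
    exact hne (Subtype.ext (by rw [← hh i, ← hh j, e]))
  have himage : ∀ G : Finset F, (G.image fun i => lineSet (h i)) ⊆ F ∧
      (G.image fun i => lineSet (h i)).card = G.card := fun G => by
    constructor
    · intro L hL
      obtain ⟨i, -, rfl⟩ := Finset.mem_image.1 hL
      rw [hh]
      exact i.2
    · refine Finset.card_image_of_injective _ fun i j hij => Subtype.ext ?_
      simpa only [hh] using hij
  by_cases hconc : NoConcurrent h l Finset.univ
  · right
    obtain ⟨T, -, hTN, hT⟩ := exists_noConcurrent_three hinj hconc (n := N)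
      (by rw [Finset.card_univ, Fintype.card_coe, hcard])
    rcases hN F h hinj T hT hTN with ⟨A, -, hAcard, hA⟩ | ⟨B, -, hBcard, hB⟩
    · have := (hA.isCell hinj).inConvexPosition
        (by rw [Finset.union_empty]; exact Finset.card_pos.1 (by omega))
      rw [Finset.union_empty] at this
      exact ⟨_, (himage A).1, (himage A).2.trans hAcard, this⟩
    · have := (hB.isCell hinj).inConvexPosition
        (by rw [Finset.empty_union]; exact Finset.card_pos.1 (by omega))
      rw [Finset.empty_union] at this
      exact ⟨_, (himage B).1, (himage B).2.trans hBcard, this⟩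
  · left
    unfold NoConcurrent at hconc
    push Not at hconc
    obtain ⟨G, -, t, y, hG, hGl⟩ := hconc
    obtain ⟨G', hG', hcard'⟩ := Finset.exists_subset_card_eq hGl
    refine ⟨_, (himage G').1, (himage G').2.trans hcard', (t, y), fun L hL => ?_⟩
    obtain ⟨i, hi, rfl⟩ := Finset.mem_image.1 hL
    exact (hG i (hG' hi)).symm

/-! ### The lower bound -/

/-- A family with few lines in convex position bounds `ESL` from below, as do its subfamilies. -/
theorem ExistsBounded.lt_ESL {N l n : ℕ} (H : ExistsBounded N l n) (hn : 1 ≤ n) :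
    N < ESL l (n + 1) := by
  classical
  obtain ⟨ι, _, h, hN, hinj, hconc, hcell⟩ := H
  by_contra! hle
  have hmem : ForcesConcurrentOrConvex l (n + 1) (ESL l (n + 1)) :=
    Nat.sInf_mem (exists_forcesConcurrentOrConvex l (n + 1) (by omega))
  obtain ⟨S, -, hS⟩ := Finset.exists_subset_card_eq
    (show ESL l (n + 1) ≤ (Finset.univ : Finset ι).card by rwa [Finset.card_univ, hN])
  have hline : Function.Injective fun i => lineSet (h i) := fun i j hij =>
    hinj (congrArg Prod.fst (lineSet_injective hij))
  have hF : NearlyGeneralPosition (S.image fun i => lineSet (h i)) := by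
    constructor
    · intro L hL
      obtain ⟨i, -, rfl⟩ := Finset.mem_image.1 hL
      exact ⟨_, _, rfl⟩
    · intro L hL M hM hne
      obtain ⟨i, -, rfl⟩ := Finset.mem_image.1 hL
      obtain ⟨j, -, rfl⟩ := Finset.mem_image.1 hM
      have hij : (h i).1 ≠ (h j).1 := hinj.ne fun e => hne (by rw [e])
      exact ⟨(cross (h i) (h j), height (h i) (cross (h i) (h j))), rfl,
        (height_eq_iff hij _).2 rfl⟩
  rcases hmem _ hF (by rw [Finset.card_image_of_injective _ hline, hS]) with
    ⟨G, hGF, hGl, ⟨t, y⟩, hG⟩ | ⟨G, hGF, hGn, hG⟩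
  · obtain ⟨G', -, rfl⟩ := Finset.subset_image_iff.1 hGF
    rw [Finset.card_image_of_injective _ hline] at hGl
    exact (hconc G' t y fun i hi => (hG _ (Finset.mem_image_of_mem _ hi)).symm).ne hGl
  · obtain ⟨G', -, rfl⟩ := Finset.subset_image_iff.1 hGF
    rw [Finset.card_image_of_injective _ hline] at hGn
    obtain ⟨A, B, hAB, hcard⟩ := exists_isCell_of_inConvexPosition hinj hG
    have := hcell A B hAB
    omega

theorem theorem1p2 (l k : ℕ) (hl : 3 ≤ l) (hk : 2 ≤ k) :
    (((l : ℤ) - 1) * ((2 * k - 2).choose (k - 1) : ℤ) ^ 2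
        - ((l : ℤ) - 3) * ((2 * k - 4).choose (k - 2) : ℤ) * ((2 * k - 2).choose (k - 1) : ℤ)
      < (ESL l (2 * k + 2) : ℤ)) ∧
    (((l : ℤ) - 1) * (((2 * k - 2).choose (k - 1) : ℤ) + 1) * ((2 * k - 3).choose (k - 1) : ℤ)
        - ((l : ℤ) - 3) * ((2 * k - 4).choose (k - 2) : ℤ) * ((2 * k - 2).choose (k - 1) : ℤ)
      < (ESL l (2 * k + 1) : ℤ)) := by

  obtain ⟨p, rfl⟩ := Nat.exists_eq_add_of_le' hk
  obtain ⟨e, rfl⟩ := Nat.exists_eq_add_of_le' hl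
  have hC : (2 * (p + 2) - 2).choose (p + 2 - 1) = (p + 1).centralBinom := by
    rw [Nat.centralBinom_eq_two_mul_choose]
    congr 1
  have hD : (2 * (p + 2) - 4).choose (p + 2 - 2) = p.centralBinom := by
    rw [Nat.centralBinom_eq_two_mul_choose]
    congr 1
  have hH : (2 * (p + 2) - 3).choose (p + 2 - 1) = (2 * p + 1).choose p := by
    rw [← Nat.choose_symm_half p]
    congr 1
  rw [hC, hD, hH]
  have hCD := centralBinom_succ_le p
  constructor
  · have h1 := (existsBounded_even hl p).lt_ESL (by omega)
    rw [show 2 * p + 5 + 1 = 2 * (p + 2) + 2 by ring, Nat.add_sub_cancel] at h1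
    have h2 : ((3 * (p + 1).centralBinom * ((p + 1).centralBinom + e * p.centralBinom) : ℕ) : ℤ) <
        (ESL (e + 3) (2 * (p + 2) + 2) : ℤ) := by exact_mod_cast h1
    refine lt_of_le_of_lt ?_ h2
    generalize (p + 1).centralBinom = C at *
    generalize p.centralBinom = D at *
    have h3 : e * C * C ≤ e * C * (4 * D) := by gcongr
    have h3 : (e * C * C : ℤ) ≤ e * C * (4 * D) := by exact_mod_cast h3
    push_cast
    nlinarith
  · rcases p with _ | p
    · -- For five lines the family of `existsBounded_four` is used instead of a bundling.
      have h1 := (existsBounded_four hl).lt_ESL (by omega)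
      have h2 : ((2 * (e + 3) : ℕ) : ℤ) < (ESL (e + 3) (2 * (0 + 2) + 1) : ℤ) := by
        exact_mod_cast h1
      refine lt_of_le_of_lt ?_ h2
      rw [show Nat.centralBinom (0 + 1) = 2 by decide, Nat.centralBinom_zero,
        Nat.choose_zero_right]
      push_cast
      linarith
    · have h1 := (existsBounded_odd hl p).lt_ESL (by omega)
      rw [show 2 * p + 6 + 1 = 2 * (p + 1 + 2) + 1 by ring, Nat.add_sub_cancel] at h1
      rw [centralBinom_succ_eq (p + 1), centralBinom_succ_eq p] at hCD ⊢
      rw [show 2 * (p + 1) + 1 = 2 * p + 3 by ring] at hCD ⊢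
      have hE : 1 ≤ (2 * p + 1).choose p := Nat.choose_pos (by omega)
      have hH2 : 2 ≤ (2 * p + 3).choose (p + 1) := by
        rw [Nat.choose_succ_succ' (2 * p + 2) p]
        have a1 : 0 < (2 * p + 2).choose p := Nat.choose_pos (by omega)
        have a2 : 0 < (2 * p + 2).choose (p + 1) := Nat.choose_pos (by omega)
        omega
      generalize (2 * p + 3).choose (p + 1) = H at *
      generalize (2 * p + 1).choose p = E at *
      have h2 : ((5 * H * (H + e * E) : ℕ) : ℤ) < (ESL (e + 3) (2 * (p + 1 + 2) + 1) : ℤ) := by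
        exact_mod_cast h1
      refine lt_of_le_of_lt ?_ h2
      have h3 : e * H * (2 * H + 1) ≤ e * H * (9 * E) := by gcongr; omega
      have h3 : (e * H * (2 * H + 1) : ℤ) ≤ e * H * (9 * E) := by exact_mod_cast h3
      have h4 : (2 : ℤ) * H ≤ H * H := by exact_mod_cast Nat.mul_le_mul_right H hH2
      push_cast
      nlinarith
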